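/- Let $m,N$ be integers with $1\le m\le N$, let $0<\alpha<\frac{2}{N+m}$, let $K\in\mathbb R$, $K\neq 0$, and let $$u_0=K(-1)^m\partial_1\partial_2\cdots\partial_m\delta\in\mathcal S'(\mathbb R^N),$$ where $\delta$ is the Dirac mass at the origin. Let $C_0(\mathbb R^N)$ be the Banach space (with the supremum norm) of continuous functions $f:\mathbb R^N\to\mathbb R$ with $f(x)\to0$ as $|x|\to\infty$. Let $G_t(x)=(4\pi t)^{-N/2}e^{-|x|^2/(4t)}$ be the Gauss kernel and let $e^{t\Delta}\varphi=G_t\star\varphi$ for $t>0$, $\varphi\in\mathcal S'(\mathbb R^N)$. Put $\Omega=\{x\in\mathbb R^N:\ x_1>0,\dots,x_m>0\}$. Then there is a continuous function $u:(0,\infty)\to C_0(\mathbb R^N)$ such that for every $t>0$ $$u(t)=e^{t\Delta}u_0-\int_0^t e^{(t-\sigma)\Delta}\big[|u(\sigma)|^\alpha u(\sigma)\big]\,d\sigma ,$$ the integral being absolutely convergent in $C_0(\mathbb R^N)$, and such that $u(t)\to u_0$ in $\mathcal S'(\mathbb R^N)$ as $t\to0^+$. Furthermore, for every $t>0$, $u(t)$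 is anti-symmetric in $x_1,\dots,x_m$, that is, replacing $x_i$ by $-x_i$ changes the sign of $u(t,x)$ for each $1\le i\le m$; and if $K>0$ then $u(t,x)>0$ for all $t>0$ and all $x\in\Omega$. -/

import Mathlib

open MeasureTheory Filter Topology
open scoped SchwartzMap ZeroAtInfty LineDeriv ContDiff ENNReal

/-- The Euclidean space `ℝ^N`. -/
abbrev RN (N : ℕ) : Type := EuclideanSpace ℝ (Fin N)

/-! ### The Gauss kernel -/

/-- The Gauss kernel `G_t(x) = (4 π t)^{-N/2} exp(-|x|^2 / (4 t))`, used for `t > 0`. -/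
noncomputable def gaussKernel (N : ℕ) (t : ℝ) (x : RN N) : ℝ :=
  (4 * Real.pi * t) ^ (-(N : ℝ) / 2) * Real.exp (-‖x‖ ^ 2 / (4 * t))

theorem gaussKernel_contDiff (N : ℕ) (t : ℝ) : ContDiff ℝ ∞ (gaussKernel N t) := by
  unfold gaussKernel
  exact contDiff_const.mul (Real.contDiff_exp.comp ((contDiff_norm_sq ℝ).neg.div_const _))

theorem exp_neg_mul_sq_schwartz_decay {N : ℕ} {c : ℝ} (hc : 0 < c) (k n : ℕ) :
    ∃ C : ℝ, ∀ x : RN N,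
      ‖x‖ ^ k * ‖iteratedFDeriv ℝ n (fun y : RN N => Real.exp (-c * ‖y‖ ^ 2)) x‖ ≤ C := by
  have hf : Function.HasTemperateGrowth (fun y : RN N => -c * ‖y‖ ^ 2) := by fun_prop
  obtain ⟨p, A, hA, hb⟩ := hf.norm_iteratedFDeriv_le_uniform n
  refine ⟨n.factorial * (max A 1) ^ n *
    ((k + p * n).factorial * Real.exp (1 + 1 / (4 * c))), fun x => ?_⟩
  have hx0 : (0 : ℝ) ≤ ‖x‖ := norm_nonneg x
  have h1 : (1 : ℝ) ≤ 1 + ‖x‖ := by linarith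
  have hD1 : (1 : ℝ) ≤ max A 1 * (1 + ‖x‖) ^ p := by
    have h2 := one_le_pow₀ h1 (n := p)
    have h3 := le_max_right A 1
    nlinarith
  have key := norm_iteratedFDeriv_comp_le (𝕜 := ℝ) (g := Real.exp)
    (f := fun y : RN N => -c * ‖y‖ ^ 2) (n := n) (N := ∞)
    Real.contDiff_exp hf.1 (by exact_mod_cast le_top) x
    (C := Real.exp (-c * ‖x‖ ^ 2)) (D := max A 1 * (1 + ‖x‖) ^ p)
    (fun i _ => by
      rw [norm_iteratedFDeriv_eq_norm_iteratedDeriv, iteratedDeriv_eq_iterate, Real.iter_deriv_exp,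
        Real.norm_eq_abs, abs_of_pos (Real.exp_pos _)])
    (fun i hi hin => by
      refine (hb i hin x).trans ?_
      calc A * (1 + ‖x‖) ^ p ≤ max A 1 * (1 + ‖x‖) ^ p := by
            gcongr
            exact le_max_left _ _
        _ = (max A 1 * (1 + ‖x‖) ^ p) ^ 1 := (pow_one _).symm
        _ ≤ _ := pow_le_pow_right₀ hD1 hi)
  have hexp : (1 + ‖x‖) ^ (k + p * n) * Real.exp (-c * ‖x‖ ^ 2) ≤
      (k + p * n).factorial * Real.exp (1 + 1 / (4 * c)) := by
    have h2 := Real.pow_div_factorial_le_exp (1 + ‖x‖) (by linarith) (k + p * n)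
    rw [div_le_iff₀ (by positivity)] at h2
    have h3 : Real.exp (1 + ‖x‖) * Real.exp (-c * ‖x‖ ^ 2) ≤ Real.exp (1 + 1 / (4 * c)) := by
      rw [← Real.exp_add]
      apply Real.exp_le_exp.mpr
      have h4 : 1 / (4 * c) - ‖x‖ + c * ‖x‖ ^ 2 = (2 * c * ‖x‖ - 1) ^ 2 / (4 * c) := by
        field_simp
        ring
      have h5 : 0 ≤ (2 * c * ‖x‖ - 1) ^ 2 / (4 * c) := by positivity
      linarith
    calc (1 + ‖x‖) ^ (k + p * n) * Real.exp (-c * ‖x‖ ^ 2)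
        ≤ Real.exp (1 + ‖x‖) * (k + p * n).factorial * Real.exp (-c * ‖x‖ ^ 2) := by gcongr
      _ = (k + p * n).factorial * (Real.exp (1 + ‖x‖) * Real.exp (-c * ‖x‖ ^ 2)) := by ring
      _ ≤ _ := by gcongr
  calc ‖x‖ ^ k * ‖iteratedFDeriv ℝ n (fun y : RN N => Real.exp (-c * ‖y‖ ^ 2)) x‖
      ≤ (1 + ‖x‖) ^ k * (n.factorial * Real.exp (-c * ‖x‖ ^ 2) *
          (max A 1 * (1 + ‖x‖) ^ p) ^ n) := by
        refine mul_le_mul ?_ key (norm_nonneg _) (by positivity)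
        exact pow_le_pow_left₀ hx0 (by linarith) k
    _ = n.factorial * (max A 1) ^ n *
          ((1 + ‖x‖) ^ (k + p * n) * Real.exp (-c * ‖x‖ ^ 2)) := by
        rw [mul_pow, pow_add, pow_mul]
        ring
    _ ≤ _ := by gcongr

theorem gaussKernel_eq (N : ℕ) (t : ℝ) :
    gaussKernel N t = fun x => (4 * Real.pi * t) ^ (-(N : ℝ) / 2) *
      Real.exp (-(1 / (4 * t)) * ‖x‖ ^ 2) := by
  funext x
  unfold gaussKernel
  congr 2
  ring

/-- `G_t` as a real-valued Schwartz function, for `t > 0`. -/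
noncomputable def gaussSchwartzReal (N : ℕ) {t : ℝ} (ht : 0 < t) : 𝓢(RN N, ℝ) :=
  ((4 * Real.pi * t) ^ (-(N : ℝ) / 2)) •
    (⟨fun x => Real.exp (-(1 / (4 * t)) * ‖x‖ ^ 2),
      Real.contDiff_exp.comp (contDiff_const.mul (contDiff_norm_sq ℝ)),
      fun k n => exp_neg_mul_sq_schwartz_decay (by positivity) k n⟩ : 𝓢(RN N, ℝ))

theorem gaussSchwartzReal_apply (N : ℕ) {t : ℝ} (ht : 0 < t) (x : RN N) :
    gaussSchwartzReal N ht x = gaussKernel N t x := by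
  rw [gaussKernel_eq]
  rfl

theorem gaussKernel_integrable (N : ℕ) {t : ℝ} (ht : 0 < t) :
    Integrable (gaussKernel N t) := by
  have h := (gaussSchwartzReal N ht).integrable (μ := volume)
  exact h.congr (Eventually.of_forall fun x => gaussSchwartzReal_apply N ht x)

/-- `G_t` as a complex-valued Schwartz function, for `t > 0`. -/
noncomputable def gaussSchwartz (N : ℕ) {t : ℝ} (ht : 0 < t) : 𝓢(RN N, ℂ) :=
  (gaussSchwartzReal N ht).postcompCLM Complex.ofRealCLM

theorem gaussSchwartz_apply (N : ℕ) {t : ℝ} (ht : 0 < t) (x : RN N) :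
    gaussSchwartz N ht x = (gaussKernel N t x : ℂ) := by
  rw [← gaussSchwartzReal_apply N ht]
  rfl

/-! ### Convolution with a tempered distribution, and the heat semigroup -/

/-- The Schwartz function `y ↦ g (x - y)`. -/
noncomputable def reflectTranslate {N : ℕ} (g : 𝓢(RN N, ℂ)) (x : RN N) : 𝓢(RN N, ℂ) :=
  SchwartzMap.compCLMOfAntilipschitz (K := 1) (g := fun y : RN N => x - y) ℂ (by fun_prop)
    (fun y z => by simp [edist_dist, dist_eq_norm, norm_sub_rev]) g

theorem reflectTranslate_apply {N : ℕ} (g : 𝓢(RN N, ℂ)) (x y : RN N) :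
    reflectTranslate g x y = g (x - y) := rfl

/-- The convolution `(g ⋆ T)(x) = ⟨T, g (x - ·)⟩` of `g ∈ 𝓢` and `T ∈ 𝓢'`, a function on `ℝ^N`. -/
noncomputable def schwartzConv {N : ℕ} (g : 𝓢(RN N, ℂ)) (T : 𝓢'(RN N, ℂ)) (x : RN N) : ℂ :=
  T (reflectTranslate g x)

/-- `e^{tΔ} T = G_t ⋆ T` for a tempered distribution `T` and `t > 0`. -/
noncomputable def heatDistribution {N : ℕ} {t : ℝ} (ht : 0 < t) (T : 𝓢'(RN N, ℂ)) (x : RN N) : ℂ :=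
  schwartzConv (gaussSchwartz N ht) T x

theorem c0_abs_le_norm {N : ℕ} (f : C₀(RN N, ℝ)) (x : RN N) : |f x| ≤ ‖f‖ := by
  rw [← ZeroAtInftyContinuousMap.norm_toBCF_eq_norm]
  exact f.toBCF.norm_coe_le_norm x

/-- `G_t ⋆ f` as an element of `C₀(ℝ^N)`, for `f ∈ C₀(ℝ^N)` and `t > 0`:
`(G_t ⋆ f)(x) = ∫ G_t(y) f(x - y) dy`. -/
noncomputable def gaussConvC0 {N : ℕ} {t : ℝ} (ht : 0 < t) (f : C₀(RN N, ℝ)) : C₀(RN N, ℝ) where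
  toFun x := ∫ y, gaussKernel N t y * f (x - y)
  continuous_toFun := by
    refine continuous_of_dominated (bound := fun y => |gaussKernel N t y| * ‖f‖)
      (fun x => ?_) (fun x => ?_) ((gaussKernel_integrable N ht).abs.mul_const _) ?_
    · exact ((gaussKernel_contDiff N t).continuous.mul
        (f.continuous.comp (continuous_const.sub continuous_id))).aestronglyMeasurable
    · refine Eventually.of_forall fun y => ?_
      rw [Real.norm_eq_abs, abs_mul]
      exact mul_le_mul_of_nonneg_left (c0_abs_le_norm f _) (abs_nonneg _)
    · exact Eventually.of_forall fun y =>
        continuous_const.mul (f.continuous.comp (continuous_id.sub continuous_const))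
  zero_at_infty' := by
    have hcg : (cocompact (RN N)).IsCountablyGenerated := by
      rw [← Metric.cobounded_eq_cocompact, ← comap_norm_atTop]
      infer_instance
    have h0 : (0 : ℝ) = ∫ _y : RN N, (0 : ℝ) := by simp
    rw [h0]
    refine tendsto_integral_filter_of_dominated_convergence
      (fun y => |gaussKernel N t y| * ‖f‖)
      (Eventually.of_forall fun x => ?_) (Eventually.of_forall fun x => ?_)
      ((gaussKernel_integrable N ht).abs.mul_const _) (Eventually.of_forall fun y => ?_)
    · exact ((gaussKernel_contDiff N t).continuous.mul
        (f.continuous.comp (continuous_const.sub continuous_id))).aestronglyMeasurable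
    · refine Eventually.of_forall fun y => ?_
      rw [Real.norm_eq_abs, abs_mul]
      exact mul_le_mul_of_nonneg_left (c0_abs_le_norm f _) (abs_nonneg _)
    · have h1 : Tendsto (fun x : RN N => x - y) (cocompact _) (cocompact _) := by
        simpa [sub_eq_add_neg] using
          (Homeomorph.addRight (-y)).isClosedEmbedding.tendsto_cocompact
      simpa using ((zero_at_infty f).comp h1).const_mul (gaussKernel N t y)

open Classical in
/-- The heat semigroup on `C₀(ℝ^N)`: `e^{tΔ} f = G_t ⋆ f` for `t > 0`, and `e^{0Δ} f = f`
(negative times never occur). -/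
noncomputable def heatC0 {N : ℕ} (t : ℝ) (f : C₀(RN N, ℝ)) : C₀(RN N, ℝ) :=
  if ht : 0 < t then gaussConvC0 ht f else f

/-! ### The integral equation -/

/-- The nonlinearity `f ↦ |f|^α f` on `C₀(ℝ^N)`. -/
noncomputable def powNonlin {N : ℕ} {α : ℝ} (hα : 0 < α) (f : C₀(RN N, ℝ)) : C₀(RN N, ℝ) where
  toFun x := |f x| ^ α * f x
  continuous_toFun :=
    ((f.continuous.abs).rpow_const fun _ => Or.inr hα.le).mul f.continuous
  zero_at_infty' := by
    have h : Tendsto (fun s : ℝ => |s| ^ α * s) (𝓝 0) (𝓝 (|0| ^ α * 0)) :=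
      ((continuous_abs.rpow_const fun _ => Or.inr hα.le).mul continuous_id).tendsto 0
    simpa [Function.comp_def] using h.comp (zero_at_infty f)

/-- `u` is a solution on `(0, ∞)` of
`u(t) = e^{tΔ} u₀ + a ∫_0^t e^{(t-σ)Δ} [|u(σ)|^α u(σ)] dσ`,
the integral being absolutely convergent in the Banach space `C₀(ℝ^N)`. -/
def IsGlobalIntegralSolution {N : ℕ} (a : ℝ) {α : ℝ} (hα : 0 < α) (u₀ : 𝓢'(RN N, ℂ))
    (u : ℝ → C₀(RN N, ℝ)) : Prop :=
  ∀ (t : ℝ) (ht : 0 < t),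
    IntervalIntegrable (fun σ => heatC0 (t - σ) (powNonlin hα (u σ))) volume 0 t ∧
    ∀ x : RN N, ((u t x : ℝ) : ℂ) = heatDistribution ht u₀ x +
      (((a • ∫ σ in (0 : ℝ)..t, heatC0 (t - σ) (powNonlin hα (u σ))) x : ℝ) : ℂ)

/-! ### Convergence in the space of tempered distributions -/

theorem c0_memLp_top {N : ℕ} (f : C₀(RN N, ℝ)) :
    MemLp (fun x => ((f x : ℝ) : ℂ)) ∞ (volume : Measure (RN N)) := by
  refine memLp_top_of_bound
    (Complex.continuous_ofReal.comp f.continuous).aestronglyMeasurable ‖f‖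
    (Eventually.of_forall fun x => ?_)
  simpa using c0_abs_le_norm f x

/-- The tempered distribution `φ ↦ ∫ φ f` given by `f ∈ C₀(ℝ^N)`. -/
noncomputable def c0ToTempered {N : ℕ} (f : C₀(RN N, ℝ)) : 𝓢'(RN N, ℂ) :=
  Lp.toTemperedDistribution (MemLp.toLp _ (c0_memLp_top f))

theorem c0ToTempered_apply {N : ℕ} (f : C₀(RN N, ℝ)) (φ : 𝓢(RN N, ℂ)) :
    c0ToTempered f φ = ∫ x, φ x * ((f x : ℝ) : ℂ) := by
  rw [c0ToTempered, Lp.toTemperedDistribution_apply]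
  refine integral_congr_ae ?_
  filter_upwards [(c0_memLp_top f).coeFn_toLp] with x hx
  rw [hx, smul_eq_mul]

/-! ### The initial value, anti-symmetry and the sector -/

/-- `u₀ = K (-1)^m ∂₁ ∂₂ ⋯ ∂_m δ`, with `δ` the Dirac mass at the origin. -/
noncomputable def initialDelta {N m : ℕ} (hm : m ≤ N) (K : ℝ) : 𝓢'(RN N, ℂ) :=
  ((K * (-1) ^ m : ℝ) : ℂ) •
    ∂^{fun i : Fin m => (EuclideanSpace.single (Fin.castLE hm i) (1 : ℝ) : RN N)}
      (TemperedDistribution.delta (0 : RN N))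

/-- The reflection `x_i ↦ -x_i`. -/
noncomputable def reflectCoord {N : ℕ} (i : Fin N) (x : RN N) : RN N :=
  WithLp.toLp 2 (Function.update (fun j => x j) i (-x i))

/-- Anti-symmetry in the first `m` coordinates. -/
def IsAntiSymmetric {N : ℕ} (m : ℕ) (f : RN N → ℝ) : Prop :=
  ∀ i : Fin N, (i : ℕ) < m → ∀ x, f (reflectCoord i x) = -f x

/-- The sector `Ω = {x : x₁ > 0, …, x_m > 0}`. -/
def sector (N m : ℕ) : Set (RN N) :=
  {x | ∀ i : Fin N, (i : ℕ) < m → 0 < x i}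

/-! ### Monotone iteration for an absorption equation in an ordered Banach space -/

section Abstract

variable {E : Type*} [NormedAddCommGroup E] [NormedSpace ℝ E]

/-! The free evolution is explicit: `H(t) = K ∏_{i ≤ m} (x_i / 2t) · G_t`, and self-similarity gives
`‖H(t)‖ ≤ C t^{-(N+m)/2}`. Hence on the functions lying between `0` and `H(t)` the nonlinearity is
Lipschitz with rate `L(t) = B t^{-β}`, `β = α(N+m)/2`. The assumption `α < 2/(N+m)` says exactly
that `β < 1`, so that `L` is integrable at `0` and has a primitive `A` with `A(0) = 0`.

The order is that of the cone of functions that are anti-symmetric in `x_1, …, x_m` and satisfy `K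
x_1 ⋯ x_m f ≥ 0`. The heat semigroup preserves this cone: on anti-symmetric functions the kernel may
be folded, and the folded kernel is a positive factor times a product of `sinh(x_j y_j / 2t)` and
exponentials (`heatC0_nonneg`). Estimates are made in the order rather than in norm: `0 ≤ F(s) ≤
b(s) H(s)` gives `S(t-s) F(s) ≤ b(s) H(t)`, which is integrable down to `s = 0`, whereas the direct
bound on `‖|u|^α u‖` by a power of `s` is not.

Absorption makes the naive Picard map order-reversing. With `v = e^A u` the source becomes `L v -
e^A nl(e^{-A} v)`, which is nonnegative and nondecreasing for `0 ≤ v ≤ e^A H`. The iteration from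
`0` then increases, its increments are at most `(A^n / n!) H`, and it converges to some `v` with `H
≤ v ≤ e^A H` (`iter_props`). Differentiating `e^{-A(s)} S(t-s) v(s)` in `s` turns the equation for
`v` into the one for `u` (`unshift`).

The outcome is the trap `e^{-A} H ≤ u ≤ H`. The lower bound gives strict positivity on the sector.
The trap gives `0 ≤ H - u ≤ (1 - e^{-A}) H`, hence the initial value, once pairings with `H(t)` are
controlled uniformly in `t`. Against an anti-symmetric function a test function may be
anti-symmetrized, which makes it `O(|x_1 ⋯ x_m|)`, and the pairing of `|x_1 ⋯ x_m|` with `|H(t)|`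
does not depend on `t` (`pairing_bound`). -/

/-- The preorder on `E` induced by a family of continuous linear functionals. -/
def ConeLE (Λ : Set (E →L[ℝ] ℝ)) (f g : E) : Prop := ∀ l ∈ Λ, l f ≤ l g

/-- A contraction semigroup `S` that is monotone for the order of `Λ`, a nonnegative free orbit
`H`, and a nonlinearity that is nondecreasing and `L t`-Lipschitz below `H t`, where `L` has
the primitive `A`. -/
structure AbsorptionSetting (Λ : Set (E →L[ℝ] ℝ)) (S : ℝ → E →L[ℝ] E) (nl : E → E)
    (H : ℝ → E) (L A : ℝ → ℝ) : Prop where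
  semigroup_cont : Continuous fun q : ℝ × E => S q.1 q.2
  semigroup_zero : ∀ f, S 0 f = f
  semigroup_add : ∀ s t f, 0 ≤ s → 0 ≤ t → S s (S t f) = S (s + t) f
  semigroup_norm : ∀ t f, ‖S t f‖ ≤ ‖f‖
  semigroup_mono : ∀ t f, ConeLE Λ 0 f → ConeLE Λ 0 (S t f)
  norm_mono : ∀ f g, ConeLE Λ 0 f → ConeLE Λ f g → ‖f‖ ≤ ‖g‖
  nl_cont : Continuous nl
  nl_zero : nl 0 = 0
  nl_mono : ∀ t f g, 0 < t → ConeLE Λ 0 f → ConeLE Λ f g → ConeLE Λ g (H t) →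
    ConeLE Λ (nl f) (nl g) ∧ ConeLE Λ (nl g - nl f) (L t • (g - f))
  orbit_cont : ContinuousOn H (Set.Ioi 0)
  orbit_nonneg : ∀ t, 0 < t → ConeLE Λ 0 (H t)
  orbit_semigroup : ∀ t s, 0 ≤ t → 0 < s → S t (H s) = H (t + s)
  rate_nonneg : ∀ t, 0 < t → 0 ≤ L t
  rate_cont : ContinuousOn L (Set.Ioi 0)
  rate_int : ∀ t, 0 < t → IntervalIntegrable L volume 0 t
  prim_zero : A 0 = 0
  prim_cont : ContinuousOn A (Set.Ici 0)
  prim_deriv : ∀ t, 0 < t → HasDerivAt A (L t) t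

/-- The Duhamel integral `∫_0^t S(t - σ) F(σ) dσ`. -/
noncomputable def duhamel (S : ℝ → E →L[ℝ] E) (F : ℝ → E) (t : ℝ) : E :=
  ∫ σ in (0 : ℝ)..t, S (t - σ) (F σ)

namespace AbsorptionSetting

variable {Λ : Set (E →L[ℝ] ℝ)} {S : ℝ → E →L[ℝ] E} {nl : E → E} {H : ℝ → E} {L A : ℝ → ℝ}

theorem orbit_norm_anti (h : AbsorptionSetting Λ S nl H L A) {s t : ℝ} (hs : 0 < s)
    (hst : s ≤ t) : ‖H t‖ ≤ ‖H s‖ := by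
  have h1 := h.orbit_semigroup (t - s) s (by linarith) hs
  rw [sub_add_cancel] at h1
  rw [← h1]
  exact h.semigroup_norm _ _

theorem prim_mono (h : AbsorptionSetting Λ S nl H L A) : MonotoneOn A (Set.Ici 0) := by
  refine monotoneOn_of_deriv_nonneg (convex_Ici 0) h.prim_cont ?_ ?_
  · intro t ht
    rw [interior_Ici] at ht
    exact (h.prim_deriv t ht).differentiableAt.differentiableWithinAt
  · intro t ht
    rw [interior_Ici] at ht
    rw [(h.prim_deriv t ht).deriv]
    exact h.rate_nonneg t ht

theorem prim_nonneg (h : AbsorptionSetting Λ S nl H L A) {t : ℝ} (ht : 0 ≤ t) : 0 ≤ A t := by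
  rw [← h.prim_zero]
  exact h.prim_mono Set.self_mem_Ici ht ht

/-! ### Duhamel integrals of sources dominated by the free orbit -/

/-- `F` is continuous on `(0, ∞)` and `0 ≤ F ≤ b H` there, with `b` locally integrable. -/
structure IsSource (Λ : Set (E →L[ℝ] ℝ)) (H : ℝ → E) (b : ℝ → ℝ) (F : ℝ → E) : Prop where
  cont : ContinuousOn F (Set.Ioi 0)
  nonneg : ∀ t, 0 < t → ConeLE Λ 0 (F t)
  le : ∀ t, 0 < t → ConeLE Λ (F t) (b t • H t)
  int : ∀ t, 0 < t → IntervalIntegrable b volume 0 t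

variable {b : ℝ → ℝ} {F : ℝ → E}

/-- Positivity of `S` applied to `b(s) H(s) - F(s)`, together with `S(t-s) H(s) = H(t)`: the
singularity of `H` at `0` disappears and only that of `b` remains. -/
theorem duhamel_integrand_le (h : AbsorptionSetting Λ S nl H L A) (hF : IsSource Λ H b F)
    {s t : ℝ} (hs : 0 < s) (hst : s ≤ t) :
    ConeLE Λ 0 (S (t - s) (F s)) ∧ ConeLE Λ (S (t - s) (F s)) (b s • H t) := by
  refine ⟨h.semigroup_mono _ _ (hF.nonneg s hs), ?_⟩
  have h1 : ConeLE Λ 0 (S (t - s) (b s • H s - F s)) := by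
    refine h.semigroup_mono _ _ fun l hl => ?_
    have := hF.le s hs l hl
    simp only [map_zero, map_sub]
    linarith
  intro l hl
  have h2 := h1 l hl
  rw [map_sub, map_smul, h.orbit_semigroup _ _ (by linarith) hs, sub_add_cancel] at h2
  simp only [map_zero, map_sub] at h2
  linarith

theorem duhamel_integrand_norm_le (h : AbsorptionSetting Λ S nl H L A) (hF : IsSource Λ H b F)
    {s t : ℝ} (hs : 0 < s) (hst : s ≤ t) : ‖S (t - s) (F s)‖ ≤ |b s| * ‖H t‖ := by
  obtain ⟨h1, h2⟩ := h.duhamel_integrand_le hF hs hst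
  have := h.norm_mono _ _ h1 h2
  rwa [norm_smul, Real.norm_eq_abs] at this

theorem duhamel_integrand_cont (h : AbsorptionSetting Λ S nl H L A)
    (hF : ContinuousOn F (Set.Ioi 0)) (t : ℝ) :
    ContinuousOn (fun s => S (t - s) (F s)) (Set.Ioi 0) :=
  h.semigroup_cont.comp_continuousOn
    ((continuousOn_const.sub continuousOn_id).prodMk hF)

theorem duhamel_integrable (h : AbsorptionSetting Λ S nl H L A) (hF : IsSource Λ H b F)
    {t : ℝ} (ht : 0 < t) : IntervalIntegrable (fun s => S (t - s) (F s)) volume 0 t := by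
  rw [intervalIntegrable_iff, Set.uIoc_of_le ht.le]
  have hb := (hF.int t ht)
  rw [intervalIntegrable_iff, Set.uIoc_of_le ht.le] at hb
  refine Integrable.mono' (hb.abs.mul_const ‖H t‖) ?_ ?_
  · exact ((h.duhamel_integrand_cont hF.cont t).mono
      (fun s hs => hs.1)).aestronglyMeasurable measurableSet_Ioc
  · filter_upwards [ae_restrict_mem measurableSet_Ioc] with s hs
    exact h.duhamel_integrand_norm_le hF hs.1 hs.2

/-- The order is tested by continuous linear functionals, which commute with the integral, so the
bounds on the integrand integrate. -/
theorem duhamel_nonneg_le [CompleteSpace E] (h : AbsorptionSetting Λ S nl H L A) (hF : IsSource Λ H b F)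
    {t : ℝ} (ht : 0 < t) :
    ConeLE Λ 0 (duhamel S F t) ∧
      ConeLE Λ (duhamel S F t) ((∫ s in (0 : ℝ)..t, b s) • H t) := by
  have hint := h.duhamel_integrable hF ht
  have key : ∀ l : E →L[ℝ] ℝ,
      l (duhamel S F t) = ∫ s in (0 : ℝ)..t, l (S (t - s) (F s)) := fun l =>
    (l.intervalIntegral_comp_comm hint).symm
  have hl (l : E →L[ℝ] ℝ) :
      IntervalIntegrable (fun s => l (S (t - s) (F s))) volume 0 t := by
    rw [intervalIntegrable_iff] at hint ⊢
    exact l.integrable_comp hint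
  constructor
  · intro l hmem
    rw [key, map_zero]
    refine intervalIntegral.integral_nonneg_of_ae_restrict ht.le ?_
    rw [← Measure.restrict_congr_set Ioc_ae_eq_Icc]
    filter_upwards [ae_restrict_mem measurableSet_Ioc] with s hs
    have := (h.duhamel_integrand_le hF hs.1 hs.2).1 l hmem
    simpa using this
  · intro l hmem
    rw [key, map_smul, smul_eq_mul, ← intervalIntegral.integral_mul_const]
    refine intervalIntegral.integral_mono_ae_restrict ht.le (hl l)
      ((hF.int t ht).mul_const _) ?_
    rw [← Measure.restrict_congr_set Ioc_ae_eq_Icc]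
    filter_upwards [ae_restrict_mem measurableSet_Ioc] with s hs
    have := (h.duhamel_integrand_le hF hs.1 hs.2).2 l hmem
    simpa using this

/-- Dominated convergence after writing the integral over the whole line with an indicator. Near
`t₀` the norm of `H` is at most its value at `t₀ / 2`, because `‖H‖` is nonincreasing. -/
theorem duhamel_continuousOn [CompleteSpace E] (h : AbsorptionSetting Λ S nl H L A) (hF : IsSource Λ H b F) :
    ContinuousOn (duhamel S F) (Set.Ioi 0) := by
  intro t₀ (ht₀ : 0 < t₀)
  refine ContinuousAt.continuousWithinAt ?_
  have hev : ∀ᶠ t in 𝓝 t₀, t ∈ Set.Ioo (t₀ / 2) (2 * t₀) :=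
    Ioo_mem_nhds (by linarith) (by linarith)
  have heq : duhamel S F =ᶠ[𝓝 t₀] fun t =>
      ∫ s, (Set.Ioc 0 t).indicator (fun s => S (t - s) (F s)) s := by
    filter_upwards [hev] with t ht
    have : (0 : ℝ) ≤ t := by linarith [ht.1]
    rw [duhamel, intervalIntegral.integral_of_le this, integral_indicator measurableSet_Ioc]
  rw [continuousAt_congr heq]
  have hb := hF.int (2 * t₀) (by linarith)
  rw [intervalIntegrable_iff, Set.uIoc_of_le (by linarith)] at hb
  refine continuousAt_of_dominated
    (bound := (Set.Ioc 0 (2 * t₀)).indicator fun s => |b s| * ‖H (t₀ / 2)‖) ?_ ?_ ?_ ?_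
  · filter_upwards [hev] with t ht
    rw [aestronglyMeasurable_indicator_iff measurableSet_Ioc]
    exact ((h.duhamel_integrand_cont hF.cont t).mono
      (fun s hs => hs.1)).aestronglyMeasurable measurableSet_Ioc
  · filter_upwards [hev] with t ht
    refine Eventually.of_forall fun s => ?_
    by_cases hs : s ∈ Set.Ioc 0 t
    · have hs' : s ∈ Set.Ioc 0 (2 * t₀) := ⟨hs.1, hs.2.trans ht.2.le⟩
      rw [Set.indicator_of_mem hs, Set.indicator_of_mem hs']
      refine (h.duhamel_integrand_norm_le hF hs.1 hs.2).trans ?_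
      gcongr
      exact h.orbit_norm_anti (by linarith) ht.1.le
    · rw [Set.indicator_of_notMem hs, norm_zero]
      exact Set.indicator_nonneg (fun _ _ => by positivity) _
  · rw [integrable_indicator_iff measurableSet_Ioc]
    exact hb.abs.mul_const _
  · have hne : ∀ᵐ s : ℝ, s ≠ t₀ := by simp [ae_iff]
    filter_upwards [hne] with s hs
    rcases lt_or_gt_of_ne hs with hlt | hgt
    · by_cases h0 : 0 < s
      · have hc : ContinuousAt (fun t => S (t - s) (F s)) t₀ := by
          have : Continuous fun t => S (t - s) (F s) :=
            h.semigroup_cont.comp ((continuous_id.sub continuous_const).prodMk continuous_const)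
          exact this.continuousAt
        refine hc.congr ?_
        filter_upwards [lt_mem_nhds hlt] with t ht
        rw [Set.indicator_of_mem]
        exact ⟨h0, le_of_lt ht⟩
      · refine (continuousAt_const (y := (0 : E))).congr (Eventually.of_forall fun t => ?_)
        exact (Set.indicator_of_notMem (fun hh => h0 hh.1) _).symm
    · refine (continuousAt_const (y := (0 : E))).congr ?_
      filter_upwards [gt_mem_nhds hgt] with t ht
      exact (Set.indicator_of_notMem (fun hh => absurd hh.2 (not_le.mpr ht)) _).symm

/-- Here `L A^n / n!` is the derivative of `A^(n+1) / (n+1)!`. The rate may be singular at `0`, so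
the fundamental theorem is used with differentiability in the open interval and continuity up to its
ends. -/
theorem prim_integral_pow (h : AbsorptionSetting Λ S nl H L A) (n : ℕ) {t : ℝ} (ht : 0 < t) :
    IntervalIntegrable (fun s => L s * (A s ^ n / n.factorial)) volume 0 t ∧
    ∫ s in (0 : ℝ)..t, L s * (A s ^ n / n.factorial) =
      A t ^ (n + 1) / (n + 1).factorial := by
  have hAc : ContinuousOn A (Set.Icc 0 t) := h.prim_cont.mono fun s hs => hs.1
  have hint : IntervalIntegrable (fun s => L s * (A s ^ n / n.factorial)) volume 0 t :=
    (h.rate_int t ht).mul_continuousOn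
      (by rw [Set.uIcc_of_le ht.le]; exact (hAc.pow n).div_const _)
  refine ⟨hint, ?_⟩
  rw [intervalIntegral.integral_eq_sub_of_hasDerivAt_of_le ht.le
    (f := fun s => A s ^ (n + 1) / (n + 1).factorial) ((hAc.pow _).div_const _) ?_ hint]
  · simp [h.prim_zero]
  · intro s hs
    have h1 := ((h.prim_deriv s hs.1).pow (n + 1)).div_const ((n + 1).factorial : ℝ)
    have e : L s * (A s ^ n / n.factorial) =
        ↑(n + 1) * A s ^ (n + 1 - 1) * L s / ↑(n + 1).factorial := by
      rw [Nat.factorial_succ, Nat.add_sub_cancel]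
      push_cast
      field_simp
    rw [e]
    exact h1

/-! ### The shifted equation and its monotone iteration -/

/-- The nonlinearity shifted to be monotone in the variable `v = e^A u`. -/
noncomputable def shiftedSource (nl : E → E) (L A : ℝ → ℝ) (v : ℝ → E) (t : ℝ) : E :=
  L t • v t - Real.exp (A t) • nl (Real.exp (-A t) • v t)

/-- The two halves of `nl_mono` exchange roles: the Lipschitz bound makes the increment nonnegative,
and monotonicity of `nl` bounds it by `L (g - f)`. The factors `e^A` and `e^{-A}` cancel in the
linear bound. -/
theorem shifted_mono (h : AbsorptionSetting Λ S nl H L A) {f g : ℝ → E} {t : ℝ} (ht : 0 < t)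
    (hf : ConeLE Λ 0 (f t)) (hfg : ConeLE Λ (f t) (g t))
    (hg : ConeLE Λ (g t) (Real.exp (A t) • H t)) :
    ConeLE Λ 0 (shiftedSource nl L A g t - shiftedSource nl L A f t) ∧
    ConeLE Λ (shiftedSource nl L A g t - shiftedSource nl L A f t) (L t • (g t - f t)) := by
  have he : Real.exp (A t) * Real.exp (-A t) = 1 := by rw [← Real.exp_add]; simp
  have hp := Real.exp_pos (A t)
  have hm := Real.exp_pos (-A t)
  obtain ⟨h1, h2⟩ := h.nl_mono t (Real.exp (-A t) • f t) (Real.exp (-A t) • g t) ht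
    (fun l hl => by
      have := hf l hl
      simp only [map_zero, map_smul, smul_eq_mul] at this ⊢
      positivity)
    (fun l hl => by
      have := hfg l hl
      simp only [map_smul, smul_eq_mul]
      gcongr)
    (fun l hl => by
      have := hg l hl
      simp only [map_smul, smul_eq_mul] at this ⊢
      calc _ ≤ Real.exp (-A t) * (Real.exp (A t) * l (H t)) := by gcongr
        _ = l (H t) := by rw [← mul_assoc, mul_comm (Real.exp (-A t)), he, one_mul])
  constructor
  · intro l hl
    have := mul_le_mul_of_nonneg_left (h2 l hl) hp.le
    simp only [shiftedSource, map_zero, map_sub, map_smul, smul_eq_mul] at this ⊢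
    have e : Real.exp (A t) * (L t * (Real.exp (-A t) * l (g t) - Real.exp (-A t) * l (f t)))
      = (Real.exp (A t) * Real.exp (-A t)) * (L t * (l (g t) - l (f t))) := by ring
    rw [e, he] at this
    linarith
  · intro l hl
    have := mul_le_mul_of_nonneg_left (h1 l hl) hp.le
    simp only [shiftedSource, map_sub, map_smul, smul_eq_mul] at this ⊢
    linarith

theorem shifted_cont (h : AbsorptionSetting Λ S nl H L A) {v : ℝ → E}
    (hv : ContinuousOn v (Set.Ioi 0)) : ContinuousOn (shiftedSource nl L A v) (Set.Ioi 0) := by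
  have hA : ContinuousOn A (Set.Ioi 0) := h.prim_cont.mono Set.Ioi_subset_Ici_self
  exact (h.rate_cont.smul hv).sub ((Real.continuous_exp.comp_continuousOn hA).smul
    (h.nl_cont.comp_continuousOn ((Real.continuous_exp.comp_continuousOn hA.neg).smul hv)))

theorem shifted_zero (h : AbsorptionSetting Λ S nl H L A) (t : ℝ) :
    shiftedSource nl L A (fun _ => 0) t = 0 := by
  simp [shiftedSource, h.nl_zero]

theorem shifted_isSource (h : AbsorptionSetting Λ S nl H L A) {v : ℝ → E}
    (hv : ContinuousOn v (Set.Ioi 0)) (h0 : ∀ t, 0 < t → ConeLE Λ 0 (v t))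
    (h1 : ∀ t, 0 < t → ConeLE Λ (v t) (Real.exp (A t) • H t)) :
    IsSource Λ H (fun t => L t * Real.exp (A t)) (shiftedSource nl L A v) := by
  have key := fun (t : ℝ) (ht : 0 < t) =>
    h.shifted_mono (f := fun _ => 0) (g := v) ht (fun _ _ => le_rfl) (h0 t ht) (h1 t ht)
  refine ⟨h.shifted_cont hv, fun t ht => ?_, fun t ht l hl => ?_, fun t ht => ?_⟩
  · simpa [h.shifted_zero] using (key t ht).1
  · have h2 := (key t ht).2 l hl
    have h3 := mul_le_mul_of_nonneg_left (h1 t ht l hl) (h.rate_nonneg t ht)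
    simp only [h.shifted_zero, sub_zero, map_smul, smul_eq_mul] at h2 h3 ⊢
    linarith
  · refine (h.rate_int t ht).mul_continuousOn ?_
    rw [Set.uIcc_of_le ht.le]
    exact Real.continuous_exp.comp_continuousOn (h.prim_cont.mono fun s hs => hs.1)

/-- The monotone iteration in the variable `v = e^A u`. -/
noncomputable def iter (S : ℝ → E →L[ℝ] E) (nl : E → E) (H : ℝ → E) (L A : ℝ → ℝ) :
    ℕ → ℝ → E
  | 0 => fun _ => 0
  | n + 1 => fun t => H t + duhamel S (shiftedSource nl L A (iter S nl H L A n)) t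

/-- All properties must be carried together: the monotonicity of the shifted source is available
only below `e^A H`, and this ceiling follows from summing the increments `A^k / k! · H`. Each
increment is the Duhamel integral of a source at most `L (A^n / n!) H`, which `prim_integral_pow`
integrates to the next term. -/
theorem iter_props [CompleteSpace E] (h : AbsorptionSetting Λ S nl H L A) (n : ℕ) :
    ContinuousOn (iter S nl H L A n) (Set.Ioi 0) ∧ ∀ t, 0 < t →
      ConeLE Λ 0 (iter S nl H L A n t) ∧
      ConeLE Λ (iter S nl H L A n t) (Real.exp (A t) • H t) ∧
      ConeLE Λ (iter S nl H L A n t)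
        ((∑ k ∈ Finset.range n, A t ^ k / k.factorial) • H t) ∧
      ConeLE Λ 0 (iter S nl H L A (n + 1) t - iter S nl H L A n t) ∧
      ConeLE Λ (iter S nl H L A (n + 1) t - iter S nl H L A n t)
        ((A t ^ n / n.factorial) • H t) := by
  have hsum : ∀ n t, 0 < t → ConeLE Λ (iter S nl H L A n t)
        ((∑ k ∈ Finset.range n, A t ^ k / k.factorial) • H t) →
        ConeLE Λ (iter S nl H L A n t) (Real.exp (A t) • H t) := by
    intro n t ht hc l hl
    have h1 := hc l hl
    have h2 := Real.sum_le_exp_of_nonneg (h.prim_nonneg ht.le) n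
    have h3 := h.orbit_nonneg t ht l hl
    simp only [map_zero, map_smul, smul_eq_mul] at h1 h3 ⊢
    exact h1.trans (mul_le_mul_of_nonneg_right h2 h3)
  induction n with
  | zero =>
    have hd : ∀ t, duhamel S (shiftedSource nl L A fun _ => (0 : E)) t = 0 := fun t => by
      simp [duhamel, h.shifted_zero]
    refine ⟨continuousOn_const, fun t ht => ⟨fun _ _ => le_rfl, ?_, fun l _ => ?_, ?_, ?_⟩⟩
    · exact hsum 0 t ht fun l _ => by simp [iter]
    · simp [iter]
    · simpa [iter, hd] using h.orbit_nonneg t ht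
    · intro l _
      simp [iter, hd]
  | succ n ih =>
    obtain ⟨hc, ih⟩ := ih
    have hsrc := h.shifted_isSource hc (fun t ht => (ih t ht).1) (fun t ht => (ih t ht).2.1)
    have hc' : ContinuousOn (iter S nl H L A (n + 1)) (Set.Ioi 0) :=
      h.orbit_cont.add (h.duhamel_continuousOn hsrc)
    have hnn : ∀ t, 0 < t → ConeLE Λ 0 (iter S nl H L A (n + 1) t) := fun t ht l hl => by
      have h1 := (ih t ht).1 l hl
      have h2 := (ih t ht).2.2.2.1 l hl
      simp only [map_zero, map_sub] at h1 h2 ⊢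
      linarith
    have hle : ∀ t, 0 < t → ConeLE Λ (iter S nl H L A (n + 1) t)
        ((∑ k ∈ Finset.range (n + 1), A t ^ k / k.factorial) • H t) := fun t ht l hl => by
      have h1 := (ih t ht).2.2.1 l hl
      have h2 := (ih t ht).2.2.2.2 l hl
      rw [Finset.sum_range_succ, add_smul]
      simp only [map_add, map_sub] at h1 h2 ⊢
      linarith
    have hsrc' := h.shifted_isSource hc' hnn (fun t ht => hsum _ t ht (hle t ht))
    have hdiff : ∀ t, 0 < t → iter S nl H L A (n + 2) t - iter S nl H L A (n + 1) t =
        duhamel S (fun s => shiftedSource nl L A (iter S nl H L A (n + 1)) s -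
          shiftedSource nl L A (iter S nl H L A n) s) t := by
      intro t ht
      simp only [duhamel, map_sub]
      rw [intervalIntegral.integral_sub (h.duhamel_integrable hsrc' ht)
        (h.duhamel_integrable hsrc ht)]
      change (H t + duhamel S _ t) - (H t + duhamel S _ t) = _
      rw [add_sub_add_left_eq_sub]
      rfl
    have hfg : ∀ t, 0 < t → ConeLE Λ (iter S nl H L A n t) (iter S nl H L A (n + 1) t) :=
      fun t ht l hl => by
        have h2 := (ih t ht).2.2.2.1 l hl
        simp only [map_zero, map_sub] at h2
        linarith
    have hd : IsSource Λ H (fun t => L t * (A t ^ n / n.factorial))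
        (fun s => shiftedSource nl L A (iter S nl H L A (n + 1)) s -
          shiftedSource nl L A (iter S nl H L A n) s) := by
      refine ⟨(h.shifted_cont hc').sub (h.shifted_cont hc), fun t ht => ?_, fun t ht l hl => ?_,
        fun t ht => (h.prim_integral_pow n ht).1⟩
      · exact (h.shifted_mono ht (ih t ht).1 (hfg t ht) (hsum _ t ht (hle t ht))).1
      · have h1 := (h.shifted_mono ht (ih t ht).1 (hfg t ht) (hsum _ t ht (hle t ht))).2 l hl
        have h2 := mul_le_mul_of_nonneg_left ((ih t ht).2.2.2.2 l hl) (h.rate_nonneg t ht)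
        simp only [map_smul, smul_eq_mul] at h1 h2 ⊢
        linarith
    refine ⟨hc', fun t ht => ⟨hnn t ht, hsum _ t ht (hle t ht), hle t ht, ?_, ?_⟩⟩
    · rw [hdiff t ht]
      exact (h.duhamel_nonneg_le hd ht).1
    · rw [hdiff t ht, ← (h.prim_integral_pow n ht).2]
      exact (h.duhamel_nonneg_le hd ht).2

/-! ### Return to the original equation -/

/-- Formally, `v = e^A u` satisfies the shifted equation if and only if `u` satisfies the original
one. No generator is available for differentiating `v` itself, so the product rule is applied for
fixed `t` to `s ↦ e^{-A(s)} S(t-s) v(s)`; this runs from `H(t)` at `s = 0` to `u(t)` at `s = t`. -/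
theorem unshift [CompleteSpace E] (h : AbsorptionSetting Λ S nl H L A) {v : ℝ → E} {b c : ℝ → ℝ}
    (hsrc : IsSource Λ H b (shiftedSource nl L A v))
    (hveq : ∀ t, 0 < t → v t = H t + duhamel S (shiftedSource nl L A v) t)
    (hnl : IsSource Λ H c (fun t => nl (Real.exp (-A t) • v t))) {t : ℝ} (ht : 0 < t) :
    Real.exp (-A t) • v t =
      H t - ∫ s in (0 : ℝ)..t, S (t - s) (nl (Real.exp (-A s) • v s)) := by
  have hee : ∀ t, Real.exp (-A t) * Real.exp (A t) = 1 := fun t => by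
    rw [← Real.exp_add]; simp
  -- `z s = S (t - s) (v s)` satisfies a linear ODE on `(0, t)`
  set f : ℝ → E := fun s => S (t - s) (shiftedSource nl L A v s) with hf
  have hfi : IntervalIntegrable f volume 0 t := h.duhamel_integrable hsrc ht
  set z : ℝ → E := fun s => H t + ∫ r in (0 : ℝ)..s, f r with hz
  have hzt : z t = v t := (hveq t ht).symm
  have hzs : ∀ s ∈ Set.Ioo 0 t, z s = S (t - s) (v s) := by
    intro s hs
    have hi := h.duhamel_integrable hsrc hs.1
    rw [hveq s hs.1, map_add, h.orbit_semigroup _ _ (by linarith [hs.2]) hs.1, sub_add_cancel,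
      duhamel, ← ContinuousLinearMap.intervalIntegral_comp_comm _ hi]
    simp only [hz]
    congr 1
    refine intervalIntegral.integral_congr fun r hr => ?_
    rw [Set.uIcc_of_le hs.1.le] at hr
    simp only [hf]
    rw [h.semigroup_add _ _ _ (by linarith [hs.2]) (by linarith [hr.2]), sub_add_sub_cancel]
  have hzc : ContinuousOn z (Set.Icc 0 t) := by
    refine continuousOn_const.add ?_
    have := intervalIntegral.continuousOn_primitive_interval' hfi Set.left_mem_uIcc
    rwa [Set.uIcc_of_le ht.le] at this
  have hfc : ContinuousOn f (Set.Ioi 0) := h.duhamel_integrand_cont hsrc.cont t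
  have hzd : ∀ s ∈ Set.Ioo 0 t, HasDerivAt z (f s) s := by
    intro s hs
    have hi : IntervalIntegrable f volume 0 s := hfi.mono_set (by
      rw [Set.uIcc_of_le hs.1.le, Set.uIcc_of_le ht.le]
      exact Set.Icc_subset_Icc_right hs.2.le)
    refine HasDerivAt.const_add (H t) (intervalIntegral.integral_hasDerivAt_right hi ?_ ?_)
    · exact hfc.stronglyMeasurableAtFilter isOpen_Ioi s hs.1
    · exact hfc.continuousAt (Ioi_mem_nhds hs.1)
  have hAct : ContinuousOn A (Set.Icc 0 t) := h.prim_cont.mono fun s hs => hs.1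
  -- The terms with `L` cancel, the one from `e^{-A}` against the one in the shifted source; only
  -- the nonlinearity is left.
  have hder : ∀ s ∈ Set.Ioo 0 t, HasDerivAt (fun s => Real.exp (-A s) • z s)
      (-S (t - s) (nl (Real.exp (-A s) • v s))) s := by
    intro s hs
    have h1 := ((h.prim_deriv s hs.1).neg.exp).smul (hzd s hs)
    refine h1.congr_deriv ?_
    rw [hzs s hs]
    simp only [hf, shiftedSource, map_sub, map_smul, smul_sub, smul_smul, Pi.neg_apply]
    rw [hee, one_smul]
    simp only [mul_neg, neg_smul]
    abel
  have hftc := intervalIntegral.integral_eq_sub_of_hasDerivAt_of_le ht.le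
    ((Real.continuous_exp.comp_continuousOn hAct.neg).smul hzc) hder
    (h.duhamel_integrable hnl ht).neg
  rw [intervalIntegral.integral_neg] at hftc
  have h0 : z 0 = H t := by simp [hz]
  simp only [Pi.smul_apply', Function.comp_apply, Pi.neg_apply, h0, h.prim_zero, hzt, neg_zero,
    Real.exp_zero, one_smul] at hftc
  have h2 := eq_add_of_sub_eq hftc.symm
  rw [sub_eq_neg_add]
  exact h2

theorem exists_solution [CompleteSpace E] (h : AbsorptionSetting Λ S nl H L A) :
    ∃ u : ℝ → E, ContinuousOn u (Set.Ioi 0) ∧ ∀ t, 0 < t →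
      ConeLE Λ (Real.exp (-A t) • H t) (u t) ∧ ConeLE Λ (u t) (H t) ∧
      IntervalIntegrable (fun s => S (t - s) (nl (u s))) volume 0 t ∧
      u t = H t - ∫ s in (0 : ℝ)..t, S (t - s) (nl (u s)) := by
  set w := iter S nl H L A with hw
  have hp := h.iter_props
  set d : ℕ → ℝ → E := fun n t => w (n + 1) t - w n t with hd
  have hdn : ∀ n t, 0 < t → ‖d n t‖ ≤ A t ^ n / n.factorial * ‖H t‖ := by
    intro n t ht
    obtain ⟨-, -, -, h1, h2⟩ := (hp n).2 t ht
    have h3 := h.norm_mono _ _ h1 h2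
    rwa [norm_smul, Real.norm_of_nonneg
      (by have := h.prim_nonneg ht.le; positivity)] at h3
  have hsm : ∀ t, 0 < t → Summable fun n => d n t := fun t ht =>
    Summable.of_norm_bounded ((Real.summable_pow_div_factorial (A t)).mul_right _)
      fun n => hdn n t ht
  set v : ℝ → E := fun t => ∑' n, d n t with hv
  have hpart : ∀ n t, ∑ k ∈ Finset.range n, d k t = w n t := by
    intro n t
    rw [hd, Finset.sum_range_sub (fun k => w k t)]
    simp [hw, iter]
  have hlim : ∀ t, 0 < t → Tendsto (fun n => w n t) atTop (𝓝 (v t)) := fun t ht => by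
    have := (hsm t ht).hasSum.tendsto_sum_nat
    simpa only [hpart] using this
  have hvc : ContinuousOn v (Set.Ioi 0) := by
    intro t (ht : 0 < t)
    refine ContinuousAt.continuousWithinAt ?_
    have hc : ContinuousOn v (Set.Icc (t / 2) (2 * t)) := by
      -- Since `A` increases and `‖H‖` decreases, the values at the two ends dominate the series
      -- uniformly on the compact interval.
      have hS : Summable fun n : ℕ => A (2 * t) ^ n / n.factorial * ‖H (t / 2)‖ :=
        (Real.summable_pow_div_factorial (A (2 * t))).mul_right ‖H (t / 2)‖
      refine continuousOn_tsum (fun n => ?_) hS fun n s hs => ?_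
      · exact ((hp (n + 1)).1.sub (hp n).1).mono fun s hs => lt_of_lt_of_le (half_pos ht) hs.1
      · have hs0 : 0 < s := lt_of_lt_of_le (half_pos ht) hs.1
        refine (hdn n s hs0).trans ?_
        have h1 := h.prim_nonneg hs0.le
        have h2 : A s ≤ A (2 * t) := h.prim_mono hs0.le
          (by simp only [Set.mem_Ici]; linarith) hs.2
        have h3 := h.orbit_norm_anti (half_pos ht) hs.1
        have h4 := h1.trans h2
        gcongr
    exact hc.continuousAt (Icc_mem_nhds (by linarith) (by linarith))
  have hv0 : ∀ t, 0 < t → ConeLE Λ 0 (v t) := fun t ht l hl =>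
    ge_of_tendsto ((l.continuous.tendsto _).comp (hlim t ht))
      (Eventually.of_forall fun n => ((hp n).2 t ht).1 l hl)
  have hv1 : ∀ t, 0 < t → ConeLE Λ (v t) (Real.exp (A t) • H t) := fun t ht l hl =>
    le_of_tendsto ((l.continuous.tendsto _).comp (hlim t ht))
      (Eventually.of_forall fun n => ((hp n).2 t ht).2.1 l hl)
  have hsrc := h.shifted_isSource hvc hv0 hv1
  have hsrcn : ∀ n, IsSource Λ H (fun t => L t * Real.exp (A t))
      (shiftedSource nl L A (w n)) := fun n =>
    h.shifted_isSource (hp n).1 (fun t ht => ((hp n).2 t ht).1) fun t ht => ((hp n).2 t ht).2.1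
  have hveq : ∀ t, 0 < t → v t = H t + duhamel S (shiftedSource nl L A v) t := by
    intro t ht
    have h1 : Tendsto (fun n => w (n + 1) t) atTop (𝓝 (v t)) :=
      (tendsto_add_atTop_iff_nat 1).mpr (hlim t ht)
    refine tendsto_nhds_unique h1 (Tendsto.const_add (H t) ?_)
    refine intervalIntegral.tendsto_integral_filter_of_dominated_convergence
      (fun s => |L s * Real.exp (A s)| * ‖H t‖) (Eventually.of_forall fun n => ?_)
      (Eventually.of_forall fun n => ?_) ((hsrc.int t ht).abs.mul_const _) ?_
    · have := h.duhamel_integrable (hsrcn n) ht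
      rw [intervalIntegrable_iff] at this
      exact this.aestronglyMeasurable
    · refine Eventually.of_forall fun s hs => ?_
      rw [Set.uIoc_of_le ht.le] at hs
      exact h.duhamel_integrand_norm_le (hsrcn n) hs.1 hs.2
    · refine Eventually.of_forall fun s hs => ?_
      rw [Set.uIoc_of_le ht.le] at hs
      refine ((S (t - s)).continuous.tendsto _).comp ?_
      have h2 := hlim s hs.1
      exact (h2.const_smul _).sub
        (((h.nl_cont.tendsto _).comp (h2.const_smul _)).const_smul _)
  set u : ℝ → E := fun t => Real.exp (-A t) • v t with hu
  have hAc : ContinuousOn A (Set.Ioi 0) := h.prim_cont.mono Set.Ioi_subset_Ici_self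
  have huc : ContinuousOn u (Set.Ioi 0) :=
    (Real.continuous_exp.comp_continuousOn hAc.neg).smul hvc
  have hee : ∀ t, Real.exp (-A t) * Real.exp (A t) = 1 := fun t => by
    rw [← Real.exp_add]; simp
  have hu0 : ∀ t, 0 < t → ConeLE Λ 0 (u t) := fun t ht l hl => by
    have := hv0 t ht l hl
    simp only [hu, map_zero, map_smul, smul_eq_mul] at this ⊢
    positivity
  have hu1 : ∀ t, 0 < t → ConeLE Λ (u t) (H t) := fun t ht l hl => by
    have := mul_le_mul_of_nonneg_left (hv1 t ht l hl) (Real.exp_pos (-A t)).le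
    simp only [hu, map_smul, smul_eq_mul] at this ⊢
    rwa [← mul_assoc, hee, one_mul] at this
  have hnl : IsSource Λ H L (fun t => nl (u t)) := by
    have key := fun (t : ℝ) (ht : 0 < t) =>
      h.nl_mono t 0 (u t) ht (fun _ _ => le_rfl) (hu0 t ht) (hu1 t ht)
    simp only [h.nl_zero, sub_zero] at key
    refine ⟨h.nl_cont.comp_continuousOn huc, fun t ht => (key t ht).1, fun t ht l hl => ?_,
      h.rate_int⟩
    have h1 := (key t ht).2 l hl
    have h2 := mul_le_mul_of_nonneg_left (hu1 t ht l hl) (h.rate_nonneg t ht)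
    simp only [map_smul, smul_eq_mul] at h1 ⊢
    linarith
  refine ⟨u, huc, fun t ht => ⟨fun l hl => ?_, hu1 t ht, h.duhamel_integrable hnl ht, ?_⟩⟩
  · have h1 := (h.duhamel_nonneg_le hsrc ht).1 l hl
    simp only [hu, map_smul, smul_eq_mul]
    rw [hveq t ht, map_add]
    rw [map_zero] at h1
    gcongr
    linarith
  · exact h.unshift hsrc hveq hnl ht

end AbsorptionSetting

end Abstract

/-! ### The heat semigroup on `C₀` -/

/-! ### Identities for the Gauss kernel -/

theorem gaussKernel_pos (N : ℕ) {t : ℝ} (ht : 0 < t) (x : RN N) : 0 < gaussKernel N t x := by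
  unfold gaussKernel
  have := Real.pi_pos
  positivity

theorem gaussKernel_continuous (N : ℕ) (t : ℝ) : Continuous (gaussKernel N t) :=
  (gaussKernel_contDiff N t).continuous

theorem gaussKernel_integral (N : ℕ) {t : ℝ} (ht : 0 < t) : ∫ x, gaussKernel N t x = 1 := by
  have hpi := Real.pi_pos
  rw [gaussKernel_eq, integral_const_mul,
    GaussianFourier.integral_rexp_neg_mul_sq_norm (V := RN N) (b := 1 / (4 * t)) (by positivity)]
  have e : Real.pi / (1 / (4 * t)) = 4 * Real.pi * t := by field_simp
  rw [e, finrank_euclideanSpace_fin, ← Real.rpow_add (by positivity)]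
  ring_nf
  simp

/-- Completing the square in `y`. The second factor on the right is a Gaussian around `(t/(t+s)) x`,
so both the semigroup law and the evolution of Gaussian monomials reduce to integrals of a centred
Gaussian. -/
theorem gaussKernel_mul (N : ℕ) {t s : ℝ} (ht : 0 < t) (hs : 0 < s) (x y : RN N) :
    gaussKernel N t y * gaussKernel N s (x - y) =
      gaussKernel N (t + s) x * gaussKernel N (t * s / (t + s)) (y - (t / (t + s)) • x) := by
  have hpi := Real.pi_pos
  have hts : t + s ≠ 0 := by positivity
  unfold gaussKernel
  rw [mul_mul_mul_comm, mul_mul_mul_comm ((4 * Real.pi * (t + s)) ^ (-(N : ℝ) / 2)),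
    ← Real.exp_add, ← Real.exp_add,
    ← Real.mul_rpow (by positivity) (by positivity), ← Real.mul_rpow (by positivity) (by positivity)]
  congr 2
  · field_simp
  · rw [norm_sub_sq_real, norm_sub_sq_real, norm_smul, inner_smul_right,
      Real.norm_of_nonneg (by positivity), real_inner_comm x y]
    field_simp
    ring

theorem gaussKernel_conv (N : ℕ) {t s : ℝ} (ht : 0 < t) (hs : 0 < s) (x : RN N) :
    ∫ y, gaussKernel N t y * gaussKernel N s (x - y) = gaussKernel N (t + s) x := by
  simp_rw [gaussKernel_mul N ht hs x]
  rw [integral_const_mul, integral_sub_right_eq_self (fun y => gaussKernel N (t * s / (t + s)) y),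
    gaussKernel_integral N (by positivity), mul_one]

theorem gaussKernel_scale (N : ℕ) {t : ℝ} (ht : 0 < t) (z : RN N) :
    gaussKernel N t (√t • z) = (√t ^ N)⁻¹ * gaussKernel N 1 z := by
  have hpi := Real.pi_pos
  unfold gaussKernel
  rw [norm_smul, Real.norm_of_nonneg (Real.sqrt_nonneg t), mul_pow, Real.sq_sqrt ht.le, mul_one,
    Real.mul_rpow (by positivity) ht.le]
  have e1 : t ^ (-(N : ℝ) / 2) = (√t ^ N)⁻¹ := by
    rw [Real.sqrt_eq_rpow, ← Real.rpow_natCast, ← Real.rpow_mul ht.le, ← Real.rpow_neg ht.le]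
    congr 1
    ring
  rw [e1]
  have e2 : -(t * ‖z‖ ^ 2) / (4 * t) = -‖z‖ ^ 2 / (4 * 1) := by field_simp
  rw [e2]
  ring

theorem gaussKernel_integral_scale {F : Type*} [NormedAddCommGroup F] [NormedSpace ℝ F] (N : ℕ)
    {t : ℝ} (ht : 0 < t) (g : RN N → F) :
    ∫ y, gaussKernel N t y • g y = ∫ z, gaussKernel N 1 z • g (√t • z) := by
  have h := Measure.integral_comp_smul (volume : Measure (RN N))
    (fun y => gaussKernel N t y • g y) (√t)
  have hp : 0 < √t ^ N := by positivity
  simp_rw [gaussKernel_scale N ht, finrank_euclideanSpace_fin, mul_smul] at h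
  rw [integral_smul, abs_of_pos (by positivity)] at h
  exact (smul_right_injective F (inv_pos.mpr hp).ne' h).symm

theorem gaussKernel_sq_integrable (N : ℕ) {t : ℝ} (ht : 0 < t) :
    Integrable fun x => gaussKernel N t x * ‖x‖ ^ 2 := by
  have h := SchwartzMap.integrable_pow_mul volume (gaussSchwartzReal N ht) 2
  refine h.congr (Eventually.of_forall fun x => ?_)
  simp only [gaussSchwartzReal_apply, Real.norm_eq_abs, abs_of_pos (gaussKernel_pos N ht x)]
  ring

/-! ### Contraction, composition and strong continuity of the semigroup -/

theorem c0_norm_le {N : ℕ} {f : C₀(RN N, ℝ)} {C : ℝ} (hC : 0 ≤ C) (h : ∀ x, |f x| ≤ C) :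
    ‖f‖ ≤ C := by
  rw [← ZeroAtInftyContinuousMap.norm_toBCF_eq_norm, BoundedContinuousFunction.norm_le hC]
  exact h

theorem gaussKernel_mul_integrable {N : ℕ} {t : ℝ} (ht : 0 < t) (f : C₀(RN N, ℝ)) (x : RN N) :
    Integrable fun y => gaussKernel N t y * f (x - y) := by
  refine Integrable.mono' ((gaussKernel_integrable N ht).abs.mul_const ‖f‖)
    ((gaussKernel_continuous N t).mul
      (f.continuous.comp (continuous_const.sub continuous_id))).aestronglyMeasurable
    (Eventually.of_forall fun y => ?_)
  rw [Real.norm_eq_abs, abs_mul]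
  exact mul_le_mul_of_nonneg_left (c0_abs_le_norm f _) (abs_nonneg _)

theorem heatC0_apply {N : ℕ} {t : ℝ} (ht : 0 < t) (f : C₀(RN N, ℝ)) (x : RN N) :
    heatC0 t f x = ∫ y, gaussKernel N t y * f (x - y) := by
  rw [heatC0, dif_pos ht]
  rfl

theorem heatC0_of_nonpos {N : ℕ} {t : ℝ} (ht : t ≤ 0) (f : C₀(RN N, ℝ)) : heatC0 t f = f := by
  rw [heatC0, dif_neg ht.not_gt]

theorem heatC0_norm_le {N : ℕ} (t : ℝ) (f : C₀(RN N, ℝ)) : ‖heatC0 t f‖ ≤ ‖f‖ := by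
  by_cases ht : 0 < t
  · refine c0_norm_le (norm_nonneg _) fun x => ?_
    rw [heatC0_apply ht]
    calc |∫ y, gaussKernel N t y * f (x - y)|
        ≤ ∫ y, |gaussKernel N t y * f (x - y)| := abs_integral_le_integral_abs
      _ ≤ ∫ y, gaussKernel N t y * ‖f‖ := by
          refine integral_mono (gaussKernel_mul_integrable ht f x).abs
            ((gaussKernel_integrable N ht).mul_const _) fun y => ?_
          simp only [abs_mul, abs_of_pos (gaussKernel_pos N ht y)]
          exact mul_le_mul_of_nonneg_left (c0_abs_le_norm f _) (gaussKernel_pos N ht y).le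
      _ = ‖f‖ := by rw [integral_mul_const, gaussKernel_integral N ht, one_mul]
  · rw [heatC0_of_nonpos (not_lt.mp ht)]

/-- The heat semigroup as a family of continuous linear maps. -/
noncomputable def heatCLM (N : ℕ) (t : ℝ) : C₀(RN N, ℝ) →L[ℝ] C₀(RN N, ℝ) :=
  LinearMap.mkContinuous
    { toFun := heatC0 t
      map_add' := fun f g => by
        by_cases ht : 0 < t
        · ext x
          simp only [ZeroAtInftyContinuousMap.coe_add, Pi.add_apply, heatC0_apply ht, mul_add]
          exact integral_add (gaussKernel_mul_integrable ht f x)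
            (gaussKernel_mul_integrable ht g x)
        · simp only [heatC0_of_nonpos (not_lt.mp ht)]
      map_smul' := fun c f => by
        by_cases ht : 0 < t
        · ext x
          simp only [ZeroAtInftyContinuousMap.coe_smul, Pi.smul_apply, heatC0_apply ht,
            RingHom.id_apply, smul_eq_mul]
          rw [← integral_const_mul]
          congr 1
          ext y
          ring
        · simp only [heatC0_of_nonpos (not_lt.mp ht), RingHom.id_apply] } 1
    fun f => by simpa using heatC0_norm_le t f

theorem heatCLM_apply {N : ℕ} (t : ℝ) (f : C₀(RN N, ℝ)) : heatCLM N t f = heatC0 t f := rfl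

theorem heatC0_add {N : ℕ} {t s : ℝ} (ht : 0 ≤ t) (hs : 0 ≤ s) (f : C₀(RN N, ℝ)) :
    heatC0 t (heatC0 s f) = heatC0 (t + s) f := by
  rcases ht.eq_or_lt with rfl | ht
  · rw [heatC0_of_nonpos le_rfl, zero_add]
  rcases hs.eq_or_lt with rfl | hs
  · rw [heatC0_of_nonpos (t := 0) le_rfl, add_zero]
  ext x
  rw [heatC0_apply ht, heatC0_apply (add_pos ht hs)]
  -- The inner variable is translated by `y`, so that `f` no longer depends on `y` and Fubini leaves
  -- the convolution of the two kernels.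
  have h1 : ∀ y, gaussKernel N t y * heatC0 s f (x - y) =
      ∫ w, gaussKernel N t y * gaussKernel N s (w - y) * f (x - w) := fun y => by
    rw [heatC0_apply hs, ← integral_const_mul,
      ← integral_sub_right_eq_self (fun z => gaussKernel N t y *
        (gaussKernel N s z * f (x - y - z))) y]
    congr 1
    ext w
    rw [sub_sub_sub_cancel_right, mul_assoc]
  simp_rw [h1]
  rw [integral_integral_swap]
  · congr 1
    ext w
    rw [integral_mul_const, gaussKernel_conv N ht hs]
  · have hc := (Integrable.convolution_integrand (ContinuousLinearMap.mul ℝ ℝ)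
      (gaussKernel_integrable N ht) (gaussKernel_integrable N hs)).swap
    refine Integrable.mono' (hc.abs.mul_const ‖f‖) ?_ (Eventually.of_forall fun p => ?_)
    · refine Continuous.aestronglyMeasurable ?_
      have := gaussKernel_continuous N t
      have := gaussKernel_continuous N s
      have := f.continuous
      unfold Function.uncurry
      fun_prop
    · simp only [Function.uncurry, Real.norm_eq_abs, Function.comp_apply, Prod.swap, abs_mul,
        ContinuousLinearMap.mul_apply']
      exact mul_le_mul_of_nonneg_left (c0_abs_le_norm f _) (by positivity)

/-- Uniform continuity handles small `y`; for `‖y‖ ≥ δ` the trivial bound `2‖f‖` is absorbed in the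
quadratic term. Only the second moment of the kernel is then needed, and it is proportional to `t`.
-/
theorem c0_modulus {N : ℕ} (f : C₀(RN N, ℝ)) {ε : ℝ} (hε : 0 < ε) :
    ∃ C, 0 ≤ C ∧ ∀ x y, |f (x - y) - f x| ≤ ε + C * ‖y‖ ^ 2 := by
  obtain ⟨δ, hδ, h⟩ := Metric.uniformContinuous_iff.mp
    (ZeroAtInftyContinuousMap.uniformContinuous f) ε hε
  refine ⟨2 * ‖f‖ / δ ^ 2, by positivity, fun x y => ?_⟩
  rcases lt_or_ge ‖y‖ δ with hy | hy
  · have := h (a := x - y) (b := x) (by simpa [dist_eq_norm] using hy)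
    rw [Real.dist_eq] at this
    have h2 : 0 ≤ 2 * ‖f‖ / δ ^ 2 * ‖y‖ ^ 2 := by positivity
    linarith
  · have h1 : |f (x - y) - f x| ≤ 2 * ‖f‖ := by
      have := abs_sub (f (x - y)) (f x)
      linarith [c0_abs_le_norm f (x - y), c0_abs_le_norm f x]
    have h2 : 2 * ‖f‖ ≤ 2 * ‖f‖ / δ ^ 2 * ‖y‖ ^ 2 := by
      rw [div_mul_eq_mul_div, le_div_iff₀ (by positivity)]
      gcongr
    linarith

theorem heatC0_sub_self_le {N : ℕ} (f : C₀(RN N, ℝ)) {ε : ℝ} (hε : 0 < ε) :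
    ∃ C, 0 ≤ C ∧ ∀ t, 0 ≤ t → ‖heatC0 t f - f‖ ≤ ε + C * t := by
  obtain ⟨C, hC, h⟩ := c0_modulus f hε
  have hM : 0 ≤ ∫ z, gaussKernel N 1 z * ‖z‖ ^ 2 :=
    integral_nonneg fun z => mul_nonneg (gaussKernel_pos N one_pos z).le (by positivity)
  refine ⟨C * ∫ z, gaussKernel N 1 z * ‖z‖ ^ 2, by positivity, fun t ht => ?_⟩
  rcases ht.eq_or_lt with rfl | ht
  · simpa [heatC0_of_nonpos le_rfl] using hε.le
  refine c0_norm_le (by positivity) fun x => ?_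
  have e : (heatC0 t f - f) x = ∫ y, gaussKernel N t y * (f (x - y) - f x) := by
    simp_rw [mul_sub]
    rw [integral_sub (gaussKernel_mul_integrable ht f x)
      ((gaussKernel_integrable N ht).mul_const _), integral_mul_const, gaussKernel_integral N ht,
      one_mul, ← heatC0_apply ht]
    rfl
  have hi : Integrable fun y => gaussKernel N t y * (ε + C * ‖y‖ ^ 2) := by
    have := ((gaussKernel_integrable N ht).mul_const ε).add
      ((gaussKernel_sq_integrable N ht).mul_const C)
    refine this.congr (Eventually.of_forall fun y => ?_)
    simp only [Pi.add_apply]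
    ring
  rw [e]
  calc |∫ y, gaussKernel N t y * (f (x - y) - f x)|
      ≤ ∫ y, |gaussKernel N t y * (f (x - y) - f x)| := abs_integral_le_integral_abs
    _ ≤ ∫ y, gaussKernel N t y * (ε + C * ‖y‖ ^ 2) := by
        refine integral_mono_of_nonneg (Eventually.of_forall fun y => abs_nonneg _) hi
          (Eventually.of_forall fun y => ?_)
        simp only [abs_mul, abs_of_pos (gaussKernel_pos N ht y)]
        exact mul_le_mul_of_nonneg_left (h x y) (gaussKernel_pos N ht y).le
    _ = ∫ z, (gaussKernel N 1 z * ε + C * t * (gaussKernel N 1 z * ‖z‖ ^ 2)) := by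
        have h1 := gaussKernel_integral_scale N ht fun y => ε + C * ‖y‖ ^ 2
        simp only [smul_eq_mul] at h1
        rw [h1]
        congr 1
        ext z
        rw [norm_smul, Real.norm_of_nonneg (Real.sqrt_nonneg t), mul_pow, Real.sq_sqrt ht.le]
        ring
    _ = ε + C * (∫ z, gaussKernel N 1 z * ‖z‖ ^ 2) * t := by
        rw [integral_add ((gaussKernel_integrable N one_pos).mul_const ε)
          ((gaussKernel_sq_integrable N one_pos).const_mul _), integral_mul_const,
          integral_const_mul, gaussKernel_integral N one_pos]
        ring

theorem heatC0_max {N : ℕ} (t : ℝ) (f : C₀(RN N, ℝ)) : heatC0 (max t 0) f = heatC0 t f := by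
  rcases le_total t 0 with h | h
  · rw [max_eq_right h, heatC0_of_nonpos le_rfl, heatC0_of_nonpos h]
  · rw [max_eq_left h]

/-- By the semigroup law and contraction, continuity at any time reduces to that at `0`. Negative
times are harmless because there `heatC0` is the identity, so that `t` may be replaced by `max t 0`.
-/
theorem heatC0_continuous {N : ℕ} (f : C₀(RN N, ℝ)) : Continuous fun t => heatC0 t f := by
  have hlt : ∀ {ε : ℝ}, 0 < ε → ∃ C, 0 ≤ C ∧ ∀ s t, 0 ≤ s → s ≤ t →
      dist (heatC0 t f) (heatC0 s f) ≤ ε + C * |t - s| := by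
    intro ε hε
    obtain ⟨C, hC, h⟩ := heatC0_sub_self_le f hε
    refine ⟨C, hC, fun s t hs hst => ?_⟩
    have e : heatC0 t f - heatC0 s f = heatCLM N s (heatC0 (t - s) f - f) := by
      rw [map_sub, heatCLM_apply, heatCLM_apply, heatC0_add hs (by linarith), add_sub_cancel]
    rw [dist_eq_norm, e, heatCLM_apply, abs_of_nonneg (by linarith)]
    exact (heatC0_norm_le _ _).trans (h _ (by linarith))
  rw [Metric.continuous_iff]
  intro s ε hε
  obtain ⟨C, hC, h⟩ := hlt (half_pos hε)
  refine ⟨ε / (2 * (C + 1)), by positivity, fun t ht => ?_⟩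
  rw [Real.dist_eq] at ht
  have hm : |max t 0 - max s 0| ≤ |t - s| := abs_max_sub_max_le_abs t s 0
  have hle : dist (heatC0 t f) (heatC0 s f) ≤ ε / 2 + C * |t - s| := by
    rw [← heatC0_max t, ← heatC0_max s]
    rcases le_total (max s 0) (max t 0) with hst | hst
    · refine (h _ _ (le_max_right _ _) hst).trans ?_
      gcongr
    · rw [dist_comm]
      refine (h _ _ (le_max_right _ _) hst).trans ?_
      rw [abs_sub_comm]
      gcongr
  have h2 : C * |t - s| ≤ C * (ε / (2 * (C + 1))) := by gcongr
  have h3 : C * (ε / (2 * (C + 1))) < ε / 2 := by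
    rw [mul_div_assoc', div_lt_div_iff₀ (by positivity) two_pos]
    nlinarith
  linarith

theorem heatCLM_continuous (N : ℕ) :
    Continuous fun q : ℝ × C₀(RN N, ℝ) => heatCLM N q.1 q.2 := by
  refine continuous_prod_of_continuous_lipschitzWith' _ 1 (fun t => ?_)
    fun f => heatC0_continuous f
  refine LipschitzWith.of_dist_le_mul fun f g => ?_
  rw [dist_eq_norm, dist_eq_norm, NNReal.coe_one, one_mul, ← map_sub]
  exact heatC0_norm_le t (f - g)

/-! ### Reflections -/

theorem reflectCoord_apply {N : ℕ} (i j : Fin N) (x : RN N) :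
    reflectCoord i x j = if j = i then -x j else x j := by
  simp only [reflectCoord, Function.update_apply]
  split_ifs with h
  · rw [h]
  · rfl

/-- The reflection `x_i ↦ -x_i` as a linear isometry. -/
noncomputable def reflectLIE {N : ℕ} (i : Fin N) : RN N ≃ₗᵢ[ℝ] RN N :=
  LinearIsometryEquiv.piLpCongrRight 2 fun j =>
    if j = i then LinearIsometryEquiv.neg ℝ else LinearIsometryEquiv.refl ℝ ℝ

theorem reflectLIE_apply {N : ℕ} (i : Fin N) (x : RN N) : reflectLIE i x = reflectCoord i x := by
  ext j
  rw [reflectCoord_apply, reflectLIE, LinearIsometryEquiv.piLpCongrRight_apply]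
  simp only
  split_ifs <;> simp

theorem reflectCoord_sub {N : ℕ} (i : Fin N) (x y : RN N) :
    reflectCoord i (x - y) = reflectCoord i x - reflectCoord i y := by
  simp only [← reflectLIE_apply, map_sub]

theorem norm_reflectCoord {N : ℕ} (i : Fin N) (x : RN N) : ‖reflectCoord i x‖ = ‖x‖ := by
  rw [← reflectLIE_apply, LinearIsometryEquiv.norm_map]

theorem reflectCoord_reflectCoord {N : ℕ} (i : Fin N) (x : RN N) :
    reflectCoord i (reflectCoord i x) = x := by
  ext j
  simp only [reflectCoord_apply]
  split_ifs <;> simp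

theorem reflectCoord_eq_self {N : ℕ} {i : Fin N} {x : RN N} (h : x i = 0) :
    reflectCoord i x = x := by
  ext j
  rw [reflectCoord_apply]
  split_ifs with hj
  · rw [hj, h, neg_zero]
  · rfl

theorem measurePreserving_reflectCoord {N : ℕ} (i : Fin N) :
    MeasurePreserving (reflectCoord i) (volume : Measure (RN N)) volume := by
  have := (reflectLIE i).measurePreserving
  rwa [show ⇑(reflectLIE i) = reflectCoord i from funext (reflectLIE_apply i)] at this

theorem measurableEmbedding_reflectCoord {N : ℕ} (i : Fin N) :
    MeasurableEmbedding (reflectCoord i : RN N → RN N) := by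
  have := (reflectLIE i).toHomeomorph.measurableEmbedding
  rwa [show ⇑(reflectLIE i).toHomeomorph = reflectCoord i from
    funext (reflectLIE_apply i)] at this

theorem integral_reflectCoord {N : ℕ} {F : Type*} [NormedAddCommGroup F] [NormedSpace ℝ F]
    (i : Fin N) (f : RN N → F) : ∫ x, f (reflectCoord i x) = ∫ x, f x :=
  (measurePreserving_reflectCoord i).integral_comp (measurableEmbedding_reflectCoord i) f

theorem integrable_reflectCoord {N : ℕ} {F : Type*} [NormedAddCommGroup F]
    (i : Fin N) {f : RN N → F} (hf : Integrable f) : Integrable fun x => f (reflectCoord i x) :=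
  (measurePreserving_reflectCoord i).integrable_comp_of_integrable hf

theorem gaussKernel_reflectCoord {N : ℕ} (i : Fin N) (t : ℝ) (x : RN N) :
    gaussKernel N t (reflectCoord i x) = gaussKernel N t x := by
  simp only [gaussKernel, norm_reflectCoord]

/-! ### The weight `x₁ ⋯ x_m` and the cone of anti-symmetric functions with its sign -/

/-- The first `m` indices. -/
def firstIdx (N m : ℕ) : Finset (Fin N) := Finset.univ.filter fun i => (i : ℕ) < m

theorem mem_firstIdx {N m : ℕ} {i : Fin N} : i ∈ firstIdx N m ↔ (i : ℕ) < m := by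
  simp [firstIdx]

/-- The product of the first `m` coordinates. -/
noncomputable def coordProd (N m : ℕ) (x : RN N) : ℝ := ∏ i ∈ firstIdx N m, x i

theorem coordProd_reflectCoord {N m : ℕ} {i : Fin N} (hi : (i : ℕ) < m) (x : RN N) :
    coordProd N m (reflectCoord i x) = -coordProd N m x := by
  have hmem := mem_firstIdx.mpr hi
  unfold coordProd
  rw [← Finset.mul_prod_erase _ _ hmem, ← Finset.mul_prod_erase _ (fun j => x j) hmem,
    reflectCoord_apply, if_pos rfl, neg_mul]
  congr 2
  refine Finset.prod_congr rfl fun j hj => ?_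
  rw [reflectCoord_apply, if_neg (Finset.ne_of_mem_erase hj)]

/-- Evaluation at a point as a continuous linear functional on `C₀`. -/
noncomputable def c0Eval {N : ℕ} (x : RN N) : C₀(RN N, ℝ) →L[ℝ] ℝ :=
  LinearMap.mkContinuous
    { toFun := fun f => f x
      map_add' := fun _ _ => rfl
      map_smul' := fun _ _ => rfl } 1 fun f => by simpa using c0_abs_le_norm f x

theorem c0Eval_apply {N : ℕ} (x : RN N) (f : C₀(RN N, ℝ)) : c0Eval x f = f x := rfl

/-- The functionals that define the cone of functions `f` that are anti-symmetric in the first `m`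
coordinates and satisfy `K x₁ ⋯ x_m f(x) ≥ 0`. -/
def signFunctionals (N m : ℕ) (K : ℝ) : Set (C₀(RN N, ℝ) →L[ℝ] ℝ) :=
  {l | ∃ x, l = (K * coordProd N m x) • c0Eval x} ∪
  {l | ∃ i : Fin N, (i : ℕ) < m ∧ ∃ (x : RN N) (c : ℝ),
    l = c • (c0Eval (reflectCoord i x) + c0Eval x)}

theorem coneLE_iff_sub {E : Type*} [NormedAddCommGroup E] [NormedSpace ℝ E]
    {Λ : Set (E →L[ℝ] ℝ)} {f g : E} : ConeLE Λ f g ↔ ConeLE Λ 0 (g - f) := by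
  simp only [ConeLE, map_zero, map_sub, sub_nonneg]

theorem coneLE_zero_iff {N m : ℕ} {K : ℝ} {f : C₀(RN N, ℝ)} :
    ConeLE (signFunctionals N m K) 0 f ↔
      IsAntiSymmetric m f ∧ ∀ x, 0 ≤ K * coordProd N m x * f x := by
  constructor
  · intro h
    refine ⟨fun i hi x => ?_, fun x => ?_⟩
    · have h1 := h _ (Or.inr ⟨i, hi, x, 1, rfl⟩)
      have h2 := h _ (Or.inr ⟨i, hi, x, -1, rfl⟩)
      simp only [map_zero, smul_apply, add_apply,
        c0Eval_apply, smul_eq_mul] at h1 h2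
      linarith
    · have h1 := h _ (Or.inl ⟨x, rfl⟩)
      simpa only [map_zero, smul_apply, c0Eval_apply, smul_eq_mul] using h1
  · rintro ⟨h1, h2⟩ l (⟨x, rfl⟩ | ⟨i, hi, x, c, rfl⟩)
    · simpa only [map_zero, smul_apply, c0Eval_apply, smul_eq_mul] using h2 x
    · simp only [map_zero, smul_apply, add_apply,
        c0Eval_apply, smul_eq_mul, h1 i hi x, neg_add_cancel, mul_zero, le_refl]

theorem coneLE_iff {N m : ℕ} {K : ℝ} {f g : C₀(RN N, ℝ)} :
    ConeLE (signFunctionals N m K) f g ↔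
      IsAntiSymmetric m (g - f : C₀(RN N, ℝ)) ∧
        ∀ x, K * coordProd N m x * f x ≤ K * coordProd N m x * g x := by
  rw [coneLE_iff_sub, coneLE_zero_iff]
  simp only [ZeroAtInftyContinuousMap.coe_sub, Pi.sub_apply, mul_sub, sub_nonneg]

theorem eq_zero_of_coordProd_eq_zero {N m : ℕ} {f : RN N → ℝ} (hf : IsAntiSymmetric m f)
    {x : RN N} (hx : coordProd N m x = 0) : f x = 0 := by
  obtain ⟨i, hi, h0⟩ := Finset.prod_eq_zero_iff.mp hx
  have := hf i (mem_firstIdx.mp hi) x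
  rw [reflectCoord_eq_self h0] at this
  linarith

/-- Where the weight vanishes, the sign condition says nothing, but anti-symmetry forces `f = 0`
there; elsewhere one divides by the weight. This makes the sup norm monotone on the cone. -/
theorem abs_le_abs_of_coneLE {N m : ℕ} {K : ℝ} (hK : K ≠ 0) {f g : C₀(RN N, ℝ)}
    (hf : ConeLE (signFunctionals N m K) 0 f) (hfg : ConeLE (signFunctionals N m K) f g)
    (x : RN N) : |f x| ≤ |g x| := by
  obtain ⟨h1, h2⟩ := coneLE_zero_iff.mp hf
  have h3 := (coneLE_iff.mp hfg).2 x
  by_cases hx : coordProd N m x = 0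
  · rw [eq_zero_of_coordProd_eq_zero h1 hx, abs_zero]
    exact abs_nonneg _
  · have hc : 0 < |K * coordProd N m x| := abs_pos.mpr (mul_ne_zero hK hx)
    refine le_of_mul_le_mul_left ?_ hc
    rw [← abs_mul, ← abs_mul]
    exact abs_le_abs_of_nonneg (h2 x) h3

theorem norm_le_of_coneLE {N m : ℕ} {K : ℝ} (hK : K ≠ 0) {f g : C₀(RN N, ℝ)}
    (hf : ConeLE (signFunctionals N m K) 0 f) (hfg : ConeLE (signFunctionals N m K) f g) :
    ‖f‖ ≤ ‖g‖ :=
  c0_norm_le (norm_nonneg _) fun x =>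
    (abs_le_abs_of_coneLE hK hf hfg x).trans (c0_abs_le_norm g x)

/-! ### The heat semigroup preserves the cone -/

theorem heatC0_antiSymmetric {N m : ℕ} (t : ℝ) {f : C₀(RN N, ℝ)} (hf : IsAntiSymmetric m f) :
    IsAntiSymmetric m (heatC0 t f) := by
  by_cases ht : 0 < t
  · intro i hi x
    rw [heatC0_apply ht, heatC0_apply ht, ← integral_reflectCoord i, ← integral_neg]
    congr 1
    ext y
    rw [gaussKernel_reflectCoord, ← reflectCoord_sub, hf i hi]
    ring
  · rwa [heatC0_of_nonpos (not_lt.mp ht)]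

/-- The Gauss kernel `G_t(x - y)` folded in the coordinates of `s`. -/
noncomputable def foldedKernel (N : ℕ) (s : Finset (Fin N)) (t : ℝ) (x y : RN N) : ℝ :=
  (4 * Real.pi * t) ^ (-(N : ℝ) / 2) * Real.exp (-(‖x‖ ^ 2 + ‖y‖ ^ 2) / (4 * t)) *
    ∏ j, if j ∈ s then Real.sinh (x j * y j / (2 * t)) else Real.exp (x j * y j / (2 * t))

theorem foldedKernel_empty (N : ℕ) {t : ℝ} (ht : 0 < t) (x y : RN N) :
    foldedKernel N ∅ t x y = gaussKernel N t (x - y) := by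
  have e : inner ℝ x y = ∑ j, x j * y j := by
    simp [PiLp.inner_apply, mul_comm]
  simp only [foldedKernel, gaussKernel, Finset.notMem_empty, if_false]
  rw [← Real.exp_sum, mul_assoc, ← Real.exp_add, norm_sub_sq_real, e, ← Finset.sum_div]
  congr 2
  field_simp
  ring

/-- Reflecting `y_i` changes only the `i`-th factor, and `(e^r - e^{-r}) / 2 = sinh r`. -/
theorem foldedKernel_insert {N : ℕ} {s : Finset (Fin N)} {i : Fin N} (hi : i ∉ s) (t : ℝ)
    (x y : RN N) : foldedKernel N (insert i s) t x y =
      (foldedKernel N s t x y - foldedKernel N s t x (reflectCoord i y)) / 2 := by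
  simp only [foldedKernel, norm_reflectCoord]
  rw [← Finset.mul_prod_erase _ _ (Finset.mem_univ i),
    ← Finset.mul_prod_erase _
      (fun j => if j ∈ s then Real.sinh (x j * y j / (2 * t)) else _) (Finset.mem_univ i),
    ← Finset.mul_prod_erase _
      (fun j => if j ∈ s then Real.sinh (x j * reflectCoord i y j / (2 * t)) else _)
      (Finset.mem_univ i)]
  simp only [Finset.mem_insert_self, if_true, hi, if_false]
  have h1 : ∏ j ∈ Finset.univ.erase i, (if j ∈ insert i s then Real.sinh (x j * y j / (2 * t))
      else Real.exp (x j * y j / (2 * t))) = ∏ j ∈ Finset.univ.erase i,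
      (if j ∈ s then Real.sinh (x j * y j / (2 * t)) else Real.exp (x j * y j / (2 * t))) :=
    Finset.prod_congr rfl fun j hj => by
      simp only [Finset.mem_insert, Finset.ne_of_mem_erase hj, false_or]
  have h2 : ∏ j ∈ Finset.univ.erase i, (if j ∈ s then
      Real.sinh (x j * reflectCoord i y j / (2 * t))
      else Real.exp (x j * reflectCoord i y j / (2 * t))) = ∏ j ∈ Finset.univ.erase i,
      (if j ∈ s then Real.sinh (x j * y j / (2 * t)) else Real.exp (x j * y j / (2 * t))) :=
    Finset.prod_congr rfl fun j hj => by
      simp only [reflectCoord_apply, Finset.ne_of_mem_erase hj, if_false]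
  rw [h1, h2, reflectCoord_apply, if_pos rfl, Real.sinh_eq]
  have h3 : x i * -y i / (2 * t) = -(x i * y i / (2 * t)) := by ring
  rw [h3]
  ring

/-- Since `f` is odd in `y_i`, replacing the kernel by half its difference with its reflection
leaves the integral unchanged; the coordinates of `s` are folded one at a time. -/
theorem heatC0_eq_integral_foldedKernel {N m : ℕ} {t : ℝ} (ht : 0 < t) {f : C₀(RN N, ℝ)}
    (hf : IsAntiSymmetric m f) (x : RN N) (s : Finset (Fin N)) (hs : ∀ i ∈ s, (i : ℕ) < m) :
    Integrable (fun y => foldedKernel N s t x y * f y) ∧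
      heatC0 t f x = ∫ y, foldedKernel N s t x y * f y := by
  induction s using Finset.induction_on with
  | empty =>
    simp only [foldedKernel_empty N ht]
    have h1 := (gaussKernel_mul_integrable ht f x).comp_sub_left x
    simp only [sub_sub_cancel] at h1
    refine ⟨h1, ?_⟩
    rw [heatC0_apply ht, ← integral_sub_left_eq_self _ volume x]
    simp only [sub_sub_cancel]
  | insert i s hi ih =>
    obtain ⟨h1, h2⟩ := ih fun j hj => hs j (Finset.mem_insert_of_mem hj)
    have him := hs i (Finset.mem_insert_self i s)
    have h3 : Integrable fun y => foldedKernel N s t x (reflectCoord i y) * f y := by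
      refine (integrable_reflectCoord i h1).neg.congr (Eventually.of_forall fun y => ?_)
      simp only [Pi.neg_apply, hf i him]
      ring
    have h4 : ∫ y, foldedKernel N s t x (reflectCoord i y) * f y = -heatC0 t f x := by
      rw [h2, ← integral_neg,
        ← integral_reflectCoord i fun y => -(foldedKernel N s t x y * f y)]
      congr 1
      ext y
      rw [hf i him]
      ring
    have h5 : (fun y => foldedKernel N (insert i s) t x y * f y) = fun y =>
        (foldedKernel N s t x y * f y - foldedKernel N s t x (reflectCoord i y) * f y) / 2 := by
      ext y
      rw [foldedKernel_insert hi]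
      ring
    rw [h5]
    refine ⟨(h1.sub h3).div_const 2, ?_⟩
    rw [integral_div, integral_sub h1 h3, ← h2, h4]
    ring

/-- Because `r sinh(r / 2t) ≥ 0`, the fully folded kernel has the sign of `x_1 ⋯ x_m y_1 ⋯ y_m`. -/
theorem heatC0_nonneg {N m : ℕ} {K : ℝ} (t : ℝ) {f : C₀(RN N, ℝ)}
    (hf : ConeLE (signFunctionals N m K) 0 f) :
    ConeLE (signFunctionals N m K) 0 (heatC0 t f) := by
  by_cases ht : 0 < t
  swap
  · rwa [heatC0_of_nonpos (not_lt.mp ht)]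
  obtain ⟨h1, h2⟩ := coneLE_zero_iff.mp hf
  refine coneLE_zero_iff.mpr ⟨heatC0_antiSymmetric t h1, fun x => ?_⟩
  rw [(heatC0_eq_integral_foldedKernel ht h1 x (firstIdx N m) fun i => mem_firstIdx.mp).2,
    ← integral_const_mul]
  refine integral_nonneg fun y => ?_
  have hk : 0 ≤ coordProd N m x * coordProd N m y * foldedKernel N (firstIdx N m) t x y := by
    have hp : 0 ≤ coordProd N m x * coordProd N m y *
        ∏ j, if j ∈ firstIdx N m then Real.sinh (x j * y j / (2 * t))
          else Real.exp (x j * y j / (2 * t)) := by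
      have e : ∀ z : RN N, coordProd N m z = ∏ j, if j ∈ firstIdx N m then z j else 1 := by
        intro z
        rw [coordProd, Finset.prod_ite_mem, Finset.univ_inter]
      rw [e, e, ← Finset.prod_mul_distrib, ← Finset.prod_mul_distrib]
      refine Finset.prod_nonneg fun j _ => ?_
      split_ifs
      · rcases le_total 0 (x j * y j) with h | h
        · exact mul_nonneg h (Real.sinh_nonneg_iff.mpr (by positivity))
        · exact mul_nonneg_of_nonpos_of_nonpos h
            (Real.sinh_nonpos_iff.mpr (div_nonpos_of_nonpos_of_nonneg h (by positivity)))
      · positivity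
    have hc : 0 ≤ (4 * Real.pi * t) ^ (-(N : ℝ) / 2) *
        Real.exp (-(‖x‖ ^ 2 + ‖y‖ ^ 2) / (4 * t)) := by
      have := Real.pi_pos
      positivity
    have := mul_nonneg hc hp
    rw [foldedKernel]
    linarith
  by_cases hy : coordProd N m y = 0
  · simp [eq_zero_of_coordProd_eq_zero h1 hy]
  -- Multiplying by the square of the weight at `y` gives one factor to the kernel and the other to
  -- `f y`, making both nonnegative.
  · have h3 : 0 < coordProd N m y ^ 2 := by positivity
    refine le_of_mul_le_mul_right ?_ h3
    have := mul_nonneg hk (h2 y)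
    simp only [Pi.zero_apply, zero_mul]
    linarith

/-! ### The nonlinearity -/

theorem powNonlin_apply {N : ℕ} {α : ℝ} (hα : 0 < α) (f : C₀(RN N, ℝ)) (x : RN N) :
    powNonlin hα f x = |f x| ^ α * f x := rfl

/-- The second bound is convexity of `r ↦ r^(α+1)`: Bernoulli's inequality at `a/b` is the tangent
line bound at `b`. -/
theorem abs_rpow_mul_bounds {α : ℝ} (hα : 0 < α) {a b M : ℝ} (ha : 0 ≤ a) (hab : a ≤ b)
    (hb : b ≤ M) : |a| ^ α * a ≤ |b| ^ α * b ∧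
      |b| ^ α * b - |a| ^ α * a ≤ (α + 1) * M ^ α * (b - a) := by
  have hb0 := ha.trans hab
  rw [abs_of_nonneg ha, abs_of_nonneg hb0]
  refine ⟨by gcongr, ?_⟩
  rcases hb0.eq_or_lt with h0 | h0
  · have : a = 0 := by linarith
    subst this
    simp [← h0]
  have h1 := one_add_mul_self_le_rpow_one_add (s := a / b - 1)
    (by have := div_nonneg ha hb0; linarith) (p := α + 1) (by linarith)
  rw [add_sub_cancel, Real.div_rpow ha hb0, le_div_iff₀ (by positivity),
    Real.rpow_add_one h0.ne', Real.rpow_add_one' ha (by linarith)] at h1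
  have h2 : b ^ α * b - a ^ α * a ≤ (α + 1) * b ^ α * (b - a) := by
    have e : (1 + (α + 1) * (a / b - 1)) * (b ^ α * b) =
        b ^ α * b - (α + 1) * b ^ α * (b - a) := by field_simp; ring
    linarith
  refine h2.trans ?_
  have : 0 ≤ b - a := by linarith
  gcongr

theorem abs_rpow_mul_lipschitz {α : ℝ} (hα : 0 < α) {a b M : ℝ} (ha : |a| ≤ M) (hb : |b| ≤ M) :
    |(|b| ^ α * b - |a| ^ α * a)| ≤ (α + 1) * M ^ α * |b - a| := by
  wlog hab : a ≤ b generalizing a b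
  · rw [abs_sub_comm, abs_sub_comm b]
    exact this hb ha (le_of_not_ge hab)
  rw [abs_of_nonneg (sub_nonneg.mpr hab)]
  obtain ⟨ha1, ha2⟩ := abs_le.mp ha
  obtain ⟨hb1, hb2⟩ := abs_le.mp hb
  rcases le_total 0 a with h0 | h0
  · obtain ⟨h1, h2⟩ := abs_rpow_mul_bounds hα h0 hab hb2
    rwa [abs_of_nonneg (sub_nonneg.mpr h1)]
  rcases le_total 0 b with h0' | h0'
  · obtain ⟨h1, h2⟩ := abs_rpow_mul_bounds hα le_rfl h0' hb2
    obtain ⟨h3, h4⟩ := abs_rpow_mul_bounds hα le_rfl (neg_nonneg.mpr h0)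
      (by linarith : -a ≤ M)
    simp only [abs_neg, mul_neg, mul_zero, sub_zero] at h1 h2 h3 h4
    rw [abs_of_nonneg (by linarith)]
    linarith
  · obtain ⟨h1, h2⟩ := abs_rpow_mul_bounds hα (neg_nonneg.mpr h0') (neg_le_neg hab)
      (by linarith : -a ≤ M)
    simp only [abs_neg, mul_neg] at h1 h2
    rw [abs_of_nonneg (by linarith)]
    linarith

theorem powNonlin_continuous {N : ℕ} {α : ℝ} (hα : 0 < α) :
    Continuous (powNonlin (N := N) hα) := by
  refine continuous_iff_continuousAt.mpr fun f => ?_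
  refine tendsto_iff_dist_tendsto_zero.mpr ?_
  have hb : ∀ᶠ g in 𝓝 f, dist (powNonlin hα g) (powNonlin hα f) ≤
      (α + 1) * (‖f‖ + 1) ^ α * dist g f := by
    filter_upwards [Metric.ball_mem_nhds f one_pos] with g hg
    rw [Metric.mem_ball, dist_eq_norm] at hg
    have hg' : ‖g‖ ≤ ‖f‖ + 1 := by
      have := norm_le_norm_add_norm_sub' g f
      linarith
    rw [dist_eq_norm, dist_eq_norm]
    refine c0_norm_le (by positivity) fun x => ?_
    refine (abs_rpow_mul_lipschitz hα (M := ‖f‖ + 1) ?_ ?_).trans ?_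
    · linarith [c0_abs_le_norm f x]
    · linarith [c0_abs_le_norm g x]
    · exact mul_le_mul_of_nonneg_left (c0_abs_le_norm (g - f) x) (by positivity)
  refine squeeze_zero' (Eventually.of_forall fun _ => dist_nonneg) hb ?_
  have : Tendsto (fun g => dist g f) (𝓝 f) (𝓝 0) := tendsto_iff_dist_tendsto_zero.mp tendsto_id
  simpa using this.const_mul ((α + 1) * (‖f‖ + 1) ^ α)

theorem powNonlin_zero {N : ℕ} {α : ℝ} (hα : 0 < α) : powNonlin (N := N) hα 0 = 0 := by
  ext x
  simp [powNonlin_apply]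

theorem powNonlin_antiSymmetric {N m : ℕ} {α : ℝ} (hα : 0 < α) {f : C₀(RN N, ℝ)}
    (hf : IsAntiSymmetric m f) : IsAntiSymmetric m (powNonlin hα f) := by
  intro i hi x
  rw [powNonlin_apply, powNonlin_apply, hf i hi, abs_neg, mul_neg]

theorem IsAntiSymmetric.sub {N m : ℕ} {f g : C₀(RN N, ℝ)} (hf : IsAntiSymmetric m f)
    (hg : IsAntiSymmetric m g) : IsAntiSymmetric m (f - g : C₀(RN N, ℝ)) := by
  intro i hi x
  simp only [ZeroAtInftyContinuousMap.coe_sub, Pi.sub_apply, hf i hi, hg i hi]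
  ring

theorem IsAntiSymmetric.smul {N m : ℕ} {f : C₀(RN N, ℝ)} (c : ℝ) (hf : IsAntiSymmetric m f) :
    IsAntiSymmetric m (c • f : C₀(RN N, ℝ)) := by
  intro i hi x
  simp only [ZeroAtInftyContinuousMap.coe_smul, Pi.smul_apply, smul_eq_mul, hf i hi]
  ring

theorem powNonlin_mono {N m : ℕ} {K α M : ℝ} (hα : 0 < α) {f g : C₀(RN N, ℝ)}
    (hf : ConeLE (signFunctionals N m K) 0 f) (hfg : ConeLE (signFunctionals N m K) f g)
    (hg : ‖g‖ ≤ M) :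
    ConeLE (signFunctionals N m K) (powNonlin hα f) (powNonlin hα g) ∧
    ConeLE (signFunctionals N m K) (powNonlin hα g - powNonlin hα f)
      (((α + 1) * M ^ α) • (g - f)) := by
  obtain ⟨f1, f2⟩ := coneLE_zero_iff.mp hf
  obtain ⟨d1, d2⟩ := coneLE_iff.mp hfg
  have g1 : IsAntiSymmetric m g := fun i hi x => by
    have h1 := d1 i hi x
    have h2 := f1 i hi x
    simp only [ZeroAtInftyContinuousMap.coe_sub, Pi.sub_apply] at h1
    linarith
  have hN := (powNonlin_antiSymmetric hα g1).sub (powNonlin_antiSymmetric hα f1)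
  have key : ∀ x, K * coordProd N m x * powNonlin hα f x ≤
      K * coordProd N m x * powNonlin hα g x ∧
      K * coordProd N m x * (powNonlin hα g x - powNonlin hα f x) ≤
        K * coordProd N m x * ((α + 1) * M ^ α * (g x - f x)) := by
    intro x
    have hgx := abs_le.mp ((c0_abs_le_norm g x).trans hg)
    have hfx := f2 x
    have hdx := d2 x
    simp only [powNonlin_apply]
    -- Where the weight is negative, the scalar bounds apply to `-f x` and `-g x`, the nonlinearity
    -- being odd.
    rcases lt_trichotomy (K * coordProd N m x) 0 with hc | hc | hc
    · obtain ⟨h1, h2⟩ := abs_rpow_mul_bounds hα (a := -f x) (b := -g x) (M := M)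
        (by nlinarith) (by nlinarith) (by linarith)
      simp only [abs_neg, mul_neg] at h1 h2
      constructor
      · exact mul_le_mul_of_nonpos_left (by linarith) hc.le
      · exact mul_le_mul_of_nonpos_left (by linarith) hc.le
    · simp [hc]
    · obtain ⟨h1, h2⟩ := abs_rpow_mul_bounds hα (a := f x) (b := g x) (M := M)
        (nonneg_of_mul_nonneg_right hfx hc) (le_of_mul_le_mul_left hdx hc) (by linarith)
      exact ⟨mul_le_mul_of_nonneg_left h1 hc.le, mul_le_mul_of_nonneg_left h2 hc.le⟩
  exact ⟨coneLE_iff.mpr ⟨hN, fun x => (key x).1⟩,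
    coneLE_iff.mpr ⟨(d1.smul _).sub hN, fun x => (key x).2⟩⟩

/-! ### The free evolution `x₁ ⋯ x_m (2t)^{-m} G_t(x)` -/

theorem hasTemperateGrowth_coord {N : ℕ} (i : Fin N) :
    Function.HasTemperateGrowth fun x : RN N => x i :=
  (EuclideanSpace.proj i : RN N →L[ℝ] ℝ).hasTemperateGrowth

theorem hasTemperateGrowth_prod {N : ℕ} {ι : Type*} (s : Finset ι) {f : ι → RN N → ℝ}
    (hf : ∀ i ∈ s, (f i).HasTemperateGrowth) :
    Function.HasTemperateGrowth fun x => ∏ i ∈ s, f i x := by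
  classical
  induction s using Finset.induction_on with
  | empty => simp
  | insert i s hi ih =>
    simp_rw [Finset.prod_insert hi]
    exact (hf i (Finset.mem_insert_self i s)).mul
      (ih fun j hj => hf j (Finset.mem_insert_of_mem hj))

/-- `∏_{i ∈ s} x_i / (2t) · G_t(x)` as a Schwartz function. -/
noncomputable def gaussMonomial {N : ℕ} (s : Finset (Fin N)) {t : ℝ} (ht : 0 < t) : 𝓢(RN N, ℝ) :=
  SchwartzMap.smulLeftCLM ℝ (fun x : RN N => ∏ i ∈ s, (x i / (2 * t))) (gaussSchwartzReal N ht)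

theorem gaussMonomial_apply {N : ℕ} (s : Finset (Fin N)) {t : ℝ} (ht : 0 < t) (x : RN N) :
    gaussMonomial s ht x = (∏ i ∈ s, (x i / (2 * t))) * gaussKernel N t x := by
  rw [gaussMonomial, SchwartzMap.smulLeftCLM_apply_apply, gaussSchwartzReal_apply, smul_eq_mul]
  refine hasTemperateGrowth_prod s fun i _ => ?_
  simp_rw [div_eq_mul_inv]
  exact (hasTemperateGrowth_coord i).mul (Function.HasTemperateGrowth.const _)

/-- The product has degree at most one in each variable, so expanding it leaves, besides the
constant term, only terms odd in some `z_i`, which integrate to zero. Equivalently, the polynomial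
is harmonic. -/
theorem gaussKernel_multilinear_mean {N : ℕ} {r : ℝ} (hr : 0 < r) (a : RN N)
    (s : Finset (Fin N)) :
    Integrable (fun z : RN N => (∏ i ∈ s, (a i - z i)) * gaussKernel N r z) ∧
      ∫ z : RN N, (∏ i ∈ s, (a i - z i)) * gaussKernel N r z = ∏ i ∈ s, a i := by
  have hint : ∀ s : Finset (Fin N),
      Integrable (fun z : RN N => (∏ i ∈ s, (a i - z i)) * gaussKernel N r z) := fun s => by
    have hg : Function.HasTemperateGrowth fun z : RN N => ∏ i ∈ s, (a i - z i) :=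
      hasTemperateGrowth_prod s fun i _ =>
        (Function.HasTemperateGrowth.const _).sub (hasTemperateGrowth_coord i)
    have h := (SchwartzMap.smulLeftCLM ℝ (fun z : RN N => ∏ i ∈ s, (a i - z i))
      (gaussSchwartzReal N hr)).integrable (μ := volume)
    refine h.congr (Eventually.of_forall fun z => ?_)
    simp only [SchwartzMap.smulLeftCLM_apply_apply hg, gaussSchwartzReal_apply, smul_eq_mul]
  refine ⟨hint s, ?_⟩
  induction s using Finset.induction_on with
  | empty => simpa using gaussKernel_integral N hr
  | insert i s hi ih =>
    have h0 : ∫ z : RN N, z i * ((∏ i ∈ s, (a i - z i)) * gaussKernel N r z) = 0 := by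
      rw [← self_eq_neg]
      conv_lhs => rw [← integral_reflectCoord i]
      rw [← integral_neg]
      congr 1
      ext z
      rw [gaussKernel_reflectCoord, reflectCoord_apply, if_pos rfl, neg_mul]
      congr 3
      refine Finset.prod_congr rfl fun j hj => ?_
      rw [reflectCoord_apply, if_neg (fun h : j = i => hi (h ▸ hj))]
    have hi1 : Integrable fun z : RN N => z i * ((∏ i ∈ s, (a i - z i)) * gaussKernel N r z) := by
      refine (((hint s).const_mul (a i)).sub (hint (insert i s))).congr
        (Eventually.of_forall fun z => ?_)
      simp only [Pi.sub_apply, Finset.prod_insert hi]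
      ring
    have e : (fun z : RN N => (∏ i ∈ insert i s, (a i - z i)) * gaussKernel N r z) = fun z =>
        a i * ((∏ i ∈ s, (a i - z i)) * gaussKernel N r z) -
          z i * ((∏ i ∈ s, (a i - z i)) * gaussKernel N r z) := by
      ext z
      rw [Finset.prod_insert hi]
      ring
    rw [e, integral_sub ((hint s).const_mul _) hi1, integral_const_mul, ih, h0,
      Finset.prod_insert hi, sub_zero]

/-- After `gaussKernel_mul`, the integral is the Gaussian mean of a multilinear product about `(1-θ)
x`. As `1 - θ = s/(t+s)`, each factor `x_i / 2s` becomes `x_i / 2(t+s)`. -/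
theorem gaussMonomial_heat {N : ℕ} (S : Finset (Fin N)) {t s : ℝ} (ht : 0 < t) (hs : 0 < s)
    (x : RN N) : ∫ y, gaussKernel N t y * gaussMonomial S hs (x - y) =
      gaussMonomial S (add_pos ht hs) x := by
  have hr : 0 < t * s / (t + s) := by positivity
  set θ := t / (t + s) with hθ
  have e : ∀ y, gaussKernel N t y * gaussMonomial S hs (x - y) =
      gaussKernel N (t + s) x * (((2 * s)⁻¹) ^ S.card) *
        ((∏ i ∈ S, (((1 - θ) • x) i - (y - θ • x) i)) *
          gaussKernel N (t * s / (t + s)) (y - θ • x)) := by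
    intro y
    rw [gaussMonomial_apply]
    have e1 : ∏ i ∈ S, ((x - y) i / (2 * s)) =
        ((2 * s)⁻¹) ^ S.card * ∏ i ∈ S, (((1 - θ) • x) i - (y - θ • x) i) := by
      rw [← Finset.prod_const, ← Finset.prod_mul_distrib]
      refine Finset.prod_congr rfl fun i _ => ?_
      simp only [PiLp.sub_apply, PiLp.smul_apply, smul_eq_mul]
      field_simp
      ring
    rw [e1]
    have := gaussKernel_mul N ht hs x y
    linear_combination (((2 * s)⁻¹) ^ S.card * ∏ i ∈ S, (((1 - θ) • x) i - (y - θ • x) i)) * this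
  simp_rw [e]
  rw [integral_const_mul, integral_sub_right_eq_self (fun z : RN N =>
    (∏ i ∈ S, (((1 - θ) • x) i - z i)) * gaussKernel N (t * s / (t + s)) z),
    (gaussKernel_multilinear_mean hr _ S).2, gaussMonomial_apply, mul_assoc, mul_comm]
  congr 1
  rw [← Finset.prod_const, ← Finset.prod_mul_distrib]
  refine Finset.prod_congr rfl fun i _ => ?_
  simp only [PiLp.smul_apply, smul_eq_mul, hθ]
  field_simp
  ring

theorem gaussMonomial_scale {N : ℕ} (S : Finset (Fin N)) {t : ℝ} (ht : 0 < t) (z : RN N) :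
    gaussMonomial S ht (√t • z) = (√t ^ (N + S.card))⁻¹ * gaussMonomial S one_pos z := by
  rw [gaussMonomial_apply, gaussMonomial_apply, gaussKernel_scale N ht]
  have e : ∏ i ∈ S, ((√t • z) i / (2 * t)) = (√t ^ S.card)⁻¹ * ∏ i ∈ S, (z i / (2 * 1)) := by
    rw [← inv_pow, ← Finset.prod_const, ← Finset.prod_mul_distrib]
    refine Finset.prod_congr rfl fun i _ => ?_
    have h1 : t = √t * √t := (Real.mul_self_sqrt ht.le).symm
    have h2 : √t ≠ 0 := (Real.sqrt_pos.mpr ht).ne'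
    simp only [PiLp.smul_apply, smul_eq_mul]
    rw [show 2 * t = 2 * (√t * √t) by rw [← h1]]
    field_simp
  rw [e, pow_add, mul_inv]
  ring

theorem card_firstIdx {N m : ℕ} (hmN : m ≤ N) : (firstIdx N m).card = m := by
  rw [firstIdx, Fin.card_filter_val_lt, min_eq_right hmN]

open Classical in
/-- The free evolution `e^{tΔ} u₀` as an element of `C₀`, for `t > 0`. -/
noncomputable def freeOrbit (N m : ℕ) (K t : ℝ) : C₀(RN N, ℝ) :=
  if ht : 0 < t then K • (gaussMonomial (firstIdx N m) ht).toZeroAtInfty else 0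

theorem freeOrbit_apply {N m : ℕ} (K : ℝ) {t : ℝ} (ht : 0 < t) (x : RN N) :
    freeOrbit N m K t x = K * gaussMonomial (firstIdx N m) ht x := by
  rw [freeOrbit, dif_pos ht]
  rfl

theorem gaussMonomial_firstIdx {N m : ℕ} {t : ℝ} (ht : 0 < t) (x : RN N) :
    gaussMonomial (firstIdx N m) ht x =
      coordProd N m x * (((2 * t)⁻¹) ^ (firstIdx N m).card * gaussKernel N t x) := by
  rw [gaussMonomial_apply, coordProd, ← mul_assoc]
  congr 1
  rw [← Finset.prod_const, ← Finset.prod_mul_distrib]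
  rfl

theorem freeOrbit_semigroup {N m : ℕ} (K : ℝ) {t s : ℝ} (ht : 0 ≤ t) (hs : 0 < s) :
    heatC0 t (freeOrbit N m K s) = freeOrbit N m K (t + s) := by
  rcases ht.eq_or_lt with rfl | ht
  · rw [heatC0_of_nonpos le_rfl, zero_add]
  ext x
  rw [heatC0_apply ht, freeOrbit_apply K (add_pos ht hs), ← gaussMonomial_heat _ ht hs,
    ← integral_const_mul]
  congr 1
  ext y
  rw [freeOrbit_apply K hs]
  ring

theorem freeOrbit_nonneg {N m : ℕ} (K : ℝ) {t : ℝ} (ht : 0 < t) :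
    ConeLE (signFunctionals N m K) 0 (freeOrbit N m K t) := by
  refine coneLE_zero_iff.mpr ⟨fun i hi x => ?_, fun x => ?_⟩
  · rw [freeOrbit_apply K ht, freeOrbit_apply K ht, gaussMonomial_firstIdx,
      gaussMonomial_firstIdx, coordProd_reflectCoord hi, gaussKernel_reflectCoord]
    ring
  · rw [freeOrbit_apply K ht, gaussMonomial_firstIdx]
    have h1 := gaussKernel_pos N ht x
    have h2 : 0 ≤ ((2 * t)⁻¹) ^ (firstIdx N m).card * gaussKernel N t x := by positivity
    have h3 := mul_nonneg (mul_self_nonneg (K * coordProd N m x)) h2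
    linarith

/-- Parabolic self-similarity: the mass of `G_t` costs `√t^N` and each of the `m` derivatives
another `√t`. The critical exponent `2/(N+m)` originates here. -/
theorem freeOrbit_norm_le {N m : ℕ} (hmN : m ≤ N) (K : ℝ) {t : ℝ} (ht : 0 < t) :
    ‖freeOrbit N m K t‖ ≤ t ^ (-((N : ℝ) + m) / 2) * ‖freeOrbit N m K 1‖ := by
  refine c0_norm_le (by positivity) fun x => ?_
  have hst : 0 < √t := Real.sqrt_pos.mpr ht
  have e : x = √t • ((√t)⁻¹ • x) := by rw [smul_smul, mul_inv_cancel₀ hst.ne', one_smul]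
  have e2 : freeOrbit N m K t x = t ^ (-((N : ℝ) + m) / 2) *
      freeOrbit N m K 1 ((√t)⁻¹ • x) := by
    rw [freeOrbit_apply K ht, freeOrbit_apply K one_pos]
    conv_lhs => rw [e]
    rw [gaussMonomial_scale, card_firstIdx hmN]
    have e1 : t ^ (-((N : ℝ) + m) / 2) = (√t ^ (N + m))⁻¹ := by
      rw [Real.sqrt_eq_rpow, ← Real.rpow_natCast, ← Real.rpow_mul ht.le, ← Real.rpow_neg ht.le]
      congr 1
      push_cast
      ring
    rw [e1]
    ring
  rw [e2, abs_mul, abs_of_pos (by positivity)]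
  gcongr
  exact c0_abs_le_norm _ _

/-- Near `t` the orbit is the semigroup started from its value at time `t / 2`, so strong continuity
suffices. -/
theorem freeOrbit_continuousOn {N m : ℕ} (K : ℝ) :
    ContinuousOn (freeOrbit N m K) (Set.Ioi 0) := by
  intro t (ht : 0 < t)
  refine ContinuousAt.continuousWithinAt ?_
  have h1 : ContinuousAt (fun r => heatC0 (r - t / 2) (freeOrbit N m K (t / 2))) t :=
    ((heatC0_continuous _).comp (continuous_id.sub continuous_const)).continuousAt
  refine h1.congr ?_
  filter_upwards [lt_mem_nhds (half_lt_self ht)] with r hr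
  rw [freeOrbit_semigroup K (by linarith) (half_pos ht), sub_add_cancel]

/-! ### Coordinate derivatives of Gaussian monomials -/

/-- The composition of the derivatives `∂_i` for `i` in a list. -/
noncomputable def coordDeriv {N : ℕ} : List (Fin N) → 𝓢(RN N, ℂ) → 𝓢(RN N, ℂ)
  | [], φ => φ
  | i :: l, φ => coordDeriv l (∂_{(EuclideanSpace.single i (1 : ℝ) : RN N)} φ)

theorem coordDeriv_neg {N : ℕ} (l : List (Fin N)) (φ : 𝓢(RN N, ℂ)) :
    coordDeriv l (-φ) = -coordDeriv l φ := by
  induction l generalizing φ with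
  | nil => rfl
  | cons i l ih => rw [coordDeriv, LineDeriv.lineDerivOp_neg, ih]; rfl

theorem iteratedLineDerivOp_apply_eq_coordDeriv {N k : ℕ} (e : Fin k → Fin N)
    (T : 𝓢'(RN N, ℂ)) (φ : 𝓢(RN N, ℂ)) :
    (∂^{fun i => (EuclideanSpace.single (e i) (1 : ℝ) : RN N)} T) φ =
      (-1) ^ k * T (coordDeriv (List.ofFn e) φ) := by
  induction k generalizing φ with
  | zero => simp [coordDeriv]
  | succ k ih =>
    rw [LineDeriv.iteratedLineDerivOp_succ_left, TemperedDistribution.lineDerivOp_apply_apply]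
    have := ih (fun j => e j.succ) (-∂_{(EuclideanSpace.single (e 0) (1 : ℝ) : RN N)} φ)
    simp only [Fin.tail_def]
    rw [this, List.ofFn_succ, coordDeriv, coordDeriv_neg, map_neg, pow_succ]
    ring

/-- `gaussMonomial` as a complex Schwartz function. -/
noncomputable def gaussMonomialC {N : ℕ} (s : Finset (Fin N)) {t : ℝ} (ht : 0 < t) :
    𝓢(RN N, ℂ) :=
  (gaussMonomial s ht).postcompCLM Complex.ofRealCLM

theorem gaussMonomialC_apply {N : ℕ} (s : Finset (Fin N)) {t : ℝ} (ht : 0 < t) (x : RN N) :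
    gaussMonomialC s ht x = (gaussMonomial s ht x : ℂ) := rfl

theorem gaussMonomialC_empty {N : ℕ} {t : ℝ} (ht : 0 < t) :
    gaussMonomialC ∅ ht = gaussSchwartz N ht := by
  ext x
  rw [gaussMonomialC_apply, gaussMonomial_apply, gaussSchwartz_apply]
  simp

theorem gaussKernel_hasDerivAt_line {N : ℕ} {t : ℝ} (ht : 0 < t) (i : Fin N) (x : RN N) :
    HasDerivAt (fun r : ℝ => gaussKernel N t (x + r • EuclideanSpace.single i (1 : ℝ)))
      (-(x i / (2 * t)) * gaussKernel N t x) 0 := by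
  have e : ∀ r : ℝ, ‖x + r • (EuclideanSpace.single i (1 : ℝ) : RN N)‖ ^ 2 =
      ‖x‖ ^ 2 + 2 * x i * r + r ^ 2 := fun r => by
    rw [norm_add_sq_real, inner_smul_right, EuclideanSpace.inner_single_right, norm_smul,
      PiLp.norm_single]
    simp
    ring
  unfold gaussKernel
  simp_rw [e]
  have h1 : HasDerivAt (fun r : ℝ => -(‖x‖ ^ 2 + 2 * x i * r + r ^ 2) / (4 * t))
      (-(2 * x i) / (4 * t)) 0 := by
    have h2 := ((((hasDerivAt_id (0 : ℝ)).const_mul (2 * x i)).const_add (‖x‖ ^ 2)).add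
      ((hasDerivAt_id (0 : ℝ)).pow 2)).neg.div_const (4 * t)
    refine HasDerivAt.congr_deriv (h2.congr_of_eventuallyEq ?_) ?_
    · exact Eventually.of_forall fun r => by simp
    · simp
  refine (h1.exp.const_mul _).congr_deriv ?_
  simp only [mul_zero, add_zero, ne_eq, OfNat.ofNat_ne_zero, not_false_eq_true, zero_pow]
  field_simp
  ring

/-- As `i ∉ s`, the derivative falls only on the Gaussian, and no lower-order Hermite terms appear.
-/
theorem lineDeriv_gaussMonomialC {N : ℕ} {s : Finset (Fin N)} {i : Fin N} (hi : i ∉ s) {t : ℝ}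
    (ht : 0 < t) : ∂_{(EuclideanSpace.single i (1 : ℝ) : RN N)} (gaussMonomialC s ht) =
      -gaussMonomialC (insert i s) ht := by
  ext x
  rw [SchwartzMap.lineDerivOp_apply]
  have h1 : HasDerivAt (fun r : ℝ => gaussMonomialC s ht (x + r • EuclideanSpace.single i (1 : ℝ)))
      ((((∏ j ∈ s, (x j / (2 * t))) * (-(x i / (2 * t)) * gaussKernel N t x) : ℝ)) : ℂ) 0 := by
    have h2 := ((gaussKernel_hasDerivAt_line ht i x).const_mul
      (∏ j ∈ s, (x j / (2 * t)))).ofReal_comp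
    refine h2.congr_of_eventuallyEq (Eventually.of_forall fun r => ?_)
    simp only [gaussMonomialC_apply, gaussMonomial_apply]
    congr 2
    refine Finset.prod_congr rfl fun j hj => ?_
    have hne : j ≠ i := fun h => hi (h ▸ hj)
    simp [hne]
  have h3 : HasLineDerivAt ℝ (gaussMonomialC s ht) _ x (EuclideanSpace.single i (1 : ℝ)) := h1
  rw [h3.lineDeriv]
  simp only [neg_apply, gaussMonomialC_apply, gaussMonomial_apply,
    Finset.prod_insert hi]
  push_cast
  ring

theorem lineDeriv_reflectTranslate {N : ℕ} (g : 𝓢(RN N, ℂ)) (x v : RN N) :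
    ∂_{v} (reflectTranslate g x) = -reflectTranslate (∂_{v} g) x := by
  ext y
  simp only [SchwartzMap.lineDerivOp_apply_eq_fderiv, neg_apply,
    reflectTranslate_apply]
  have h1 : HasFDerivAt (fun y : RN N => x - y) (-ContinuousLinearMap.id ℝ (RN N)) y := by
    simpa using (hasFDerivAt_id y).const_sub x
  have h2 := (g.differentiableAt (x := x - y)).hasFDerivAt.comp y h1
  have h3 : HasFDerivAt (reflectTranslate g x) _ y := h2
  rw [h3.fderiv]
  simp

/-- Each derivative produces two signs, one from the reflection `y ↦ x - y` and one from the
Gaussian, and they cancel. -/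
theorem coordDeriv_reflectTranslate {N : ℕ} {t : ℝ} (ht : 0 < t) (x : RN N) (l : List (Fin N))
    (s : Finset (Fin N)) (hl : l.Nodup) (hd : ∀ i ∈ l, i ∉ s) :
    coordDeriv l (reflectTranslate (gaussMonomialC s ht) x) =
      reflectTranslate (gaussMonomialC (s ∪ l.toFinset) ht) x := by
  induction l generalizing s with
  | nil => simp [coordDeriv]
  | cons i l ih =>
    obtain ⟨hi, hl⟩ := List.nodup_cons.mp hl
    have h1 : -reflectTranslate (-gaussMonomialC (insert i s) ht) x =
        reflectTranslate (gaussMonomialC (insert i s) ht) x := by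
      ext y
      simp [reflectTranslate_apply]
    rw [coordDeriv, lineDeriv_reflectTranslate,
      lineDeriv_gaussMonomialC (hd i List.mem_cons_self), h1, ih _ hl]
    · congr 2
      ext j
      simp only [Finset.mem_union, Finset.mem_insert, List.toFinset_cons]
      tauto
    · intro j hj hmem
      rcases Finset.mem_insert.mp hmem with rfl | h
      · exact hi hj
      · exact hd j (List.mem_cons_of_mem _ hj) h

theorem integral_gaussMonomialC_mul_coordDeriv {N : ℕ} {t : ℝ} (ht : 0 < t) (φ : 𝓢(RN N, ℂ))
    (l : List (Fin N)) (s : Finset (Fin N)) (hl : l.Nodup) (hd : ∀ i ∈ l, i ∉ s) :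
    ∫ x, gaussMonomialC s ht x * coordDeriv l φ x =
      ∫ x, gaussMonomialC (s ∪ l.toFinset) ht x * φ x := by
  induction l generalizing φ with
  | nil => simp [coordDeriv]
  | cons i l ih =>
    obtain ⟨hi, hl⟩ := List.nodup_cons.mp hl
    have his : i ∉ s ∪ l.toFinset := by
      simp only [Finset.mem_union, List.mem_toFinset, not_or]
      exact ⟨hd i List.mem_cons_self, hi⟩
    rw [coordDeriv, ih _ hl fun j hj => hd j (List.mem_cons_of_mem _ hj),
      SchwartzMap.integral_mul_lineDerivOp_right_eq_neg_left, lineDeriv_gaussMonomialC his,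
      ← integral_neg]
    congr 1
    ext x
    rw [neg_apply, neg_mul, neg_neg, List.toFinset_cons, Finset.union_insert]

/-! ### The initial value and its free evolution -/

/-- The list of the first `m` indices. -/
def firstList {N m : ℕ} (hmN : m ≤ N) : List (Fin N) := List.ofFn (Fin.castLE hmN)

theorem firstList_nodup {N m : ℕ} (hmN : m ≤ N) : (firstList hmN).Nodup :=
  List.nodup_ofFn.mpr (Fin.castLE_injective hmN)

theorem mem_firstList {N m : ℕ} (hmN : m ≤ N) (i : Fin N) :
    i ∈ firstList hmN ↔ (i : ℕ) < m := by
  rw [firstList, List.mem_ofFn]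
  constructor
  · rintro ⟨j, rfl⟩
    exact j.2
  · intro h
    exact ⟨⟨i, h⟩, rfl⟩

theorem firstList_toFinset {N m : ℕ} (hmN : m ≤ N) : (firstList hmN).toFinset = firstIdx N m := by
  ext i
  rw [List.mem_toFinset, mem_firstList, mem_firstIdx]

/-- The `m` transposed derivatives contribute `(-1)^m`, which cancels the sign in the initial value.
-/
theorem initialDelta_apply {N m : ℕ} (hmN : m ≤ N) (K : ℝ) (φ : 𝓢(RN N, ℂ)) :
    initialDelta hmN K φ = K * coordDeriv (firstList hmN) φ 0 := by
  have h := iteratedLineDerivOp_apply_eq_coordDeriv (Fin.castLE hmN)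
    (TemperedDistribution.delta (0 : RN N)) φ
  have h2 : initialDelta hmN K φ = ((K * (-1) ^ m : ℝ) : ℂ) *
      ((∂^{fun i : Fin m => (EuclideanSpace.single (Fin.castLE hmN i) (1 : ℝ) : RN N)}
        (TemperedDistribution.delta (0 : RN N))) φ) := rfl
  rw [h2, h, TemperedDistribution.delta_apply, firstList]
  have e : ((-1 : ℂ) ^ m) * (-1) ^ m = 1 := by rw [← mul_pow]; simp
  push_cast
  linear_combination (K : ℂ) * coordDeriv (List.ofFn (Fin.castLE hmN)) φ 0 * e

theorem heatDistribution_initialDelta {N m : ℕ} (hmN : m ≤ N) (K : ℝ) {t : ℝ} (ht : 0 < t)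
    (x : RN N) : heatDistribution ht (initialDelta hmN K) x = (freeOrbit N m K t x : ℂ) := by
  rw [heatDistribution, schwartzConv, initialDelta_apply, ← gaussMonomialC_empty,
    coordDeriv_reflectTranslate ht x _ ∅ (firstList_nodup hmN) (by simp), Finset.empty_union,
    firstList_toFinset, reflectTranslate_apply, sub_zero, gaussMonomialC_apply,
    freeOrbit_apply K ht]
  push_cast
  ring

/-! ### Anti-symmetrization of test functions -/

/-- The Schwartz function `φ` composed with the reflection `x_i ↦ -x_i`. -/
noncomputable def reflectSchwartz {N : ℕ} (i : Fin N) (φ : 𝓢(RN N, ℂ)) : 𝓢(RN N, ℂ) :=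
  SchwartzMap.compCLMOfContinuousLinearEquiv ℂ (reflectLIE i).toContinuousLinearEquiv φ

theorem reflectSchwartz_apply {N : ℕ} (i : Fin N) (φ : 𝓢(RN N, ℂ)) (x : RN N) :
    reflectSchwartz i φ x = φ (reflectCoord i x) := by
  rw [← reflectLIE_apply]
  rfl

/-- The anti-symmetrization of a Schwartz function in the coordinates of a list. -/
noncomputable def antiSymmetrize {N : ℕ} : List (Fin N) → 𝓢(RN N, ℂ) → 𝓢(RN N, ℂ)
  | [], φ => φ
  | i :: l, φ => (1 / 2 : ℂ) • (antiSymmetrize l φ - reflectSchwartz i (antiSymmetrize l φ))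

/-- Reflections in other coordinates fix the direction `e_i`. -/
theorem lineDeriv_antiSymmetrize {N : ℕ} (φ : 𝓢(RN N, ℂ)) (l : List (Fin N)) {i : Fin N}
    (hi : i ∉ l) : ∂_{(EuclideanSpace.single i (1 : ℝ) : RN N)} (antiSymmetrize l φ) =
      antiSymmetrize l (∂_{(EuclideanSpace.single i (1 : ℝ) : RN N)} φ) := by
  induction l with
  | nil => rfl
  | cons j l ih =>
    have hij : i ≠ j := List.ne_of_not_mem_cons hi
    have hs : reflectCoord j (EuclideanSpace.single i (1 : ℝ) : RN N) =
        EuclideanSpace.single i 1 := by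
      refine reflectCoord_eq_self ?_
      simp [hij.symm]
    have hr : ∀ g : 𝓢(RN N, ℂ), ∂_{(EuclideanSpace.single i (1 : ℝ) : RN N)}
        (reflectSchwartz j g) =
        reflectSchwartz j (∂_{(EuclideanSpace.single i (1 : ℝ) : RN N)} g) := fun g => by
      rw [reflectSchwartz, SchwartzMap.lineDerivOp_compCLMOfContinuousLinearEquiv]
      have : (reflectLIE j).toContinuousLinearEquiv (EuclideanSpace.single i (1 : ℝ) : RN N) =
          EuclideanSpace.single i 1 := (reflectLIE_apply j _).trans hs
      rw [this]
      rfl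
    have ih' := ih (List.not_mem_of_not_mem_cons hi)
    rw [antiSymmetrize, antiSymmetrize, ← ih', ← hr,
      ← LineDeriv.lineDerivOpCLM_apply (R := ℂ), map_smul, map_sub]
    rfl

theorem schwartz_hasDerivAt_line {N : ℕ} (φ : 𝓢(RN N, ℂ)) (x v : RN N) (r : ℝ) :
    HasDerivAt (fun r : ℝ => φ (x + r • v)) ((∂_{v} φ) (x + r • v)) r := by
  rw [SchwartzMap.lineDerivOp_apply_eq_fderiv]
  have h1 : HasDerivAt (fun r : ℝ => x + r • v) v r := by
    simpa using ((hasDerivAt_id r).smul_const v).const_add x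
  exact (φ.differentiableAt (x := x + r • v)).hasFDerivAt.comp_hasDerivAt r h1

theorem reflectCoord_eq_add {N : ℕ} (i : Fin N) (x : RN N) :
    reflectCoord i x = x + (-2 * x i) • EuclideanSpace.single i (1 : ℝ) := by
  ext j
  rw [reflectCoord_apply]
  split_ifs with h
  · subst h
    simp
    ring
  · simp [h]

/-- Anti-symmetrizing in `x_i` takes half a difference between points at distance `2|x_i|`, so the
mean value inequality gains the factor `|x_i|` and costs one derivative. The induction therefore
runs over all `φ`, with `∂_i φ` in place of `φ`. -/
theorem antiSymmetrize_bound {N : ℕ} (φ : 𝓢(RN N, ℂ)) (l : List (Fin N)) (hl : l.Nodup) :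
    ∃ C, 0 ≤ C ∧ ∀ x, ‖antiSymmetrize l φ x‖ ≤ C * ∏ i ∈ l.toFinset, |x i| := by
  induction l generalizing φ with
  | nil =>
    obtain ⟨C, hC, h⟩ := φ.decay 0 0
    refine ⟨C, hC.le, fun x => ?_⟩
    simpa [antiSymmetrize] using h x
  | cons i l ih =>
    obtain ⟨hi, hl⟩ := List.nodup_cons.mp hl
    obtain ⟨C, hC, h⟩ := ih (∂_{(EuclideanSpace.single i (1 : ℝ) : RN N)} φ) hl
    refine ⟨C, hC, fun x => ?_⟩
    have hb : ∀ r : ℝ, ‖(∂_{(EuclideanSpace.single i (1 : ℝ) : RN N)} (antiSymmetrize l φ))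
        (x + r • EuclideanSpace.single i (1 : ℝ))‖ ≤ C * ∏ j ∈ l.toFinset, |x j| := by
      intro r
      rw [lineDeriv_antiSymmetrize φ l hi]
      refine (h _).trans (le_of_eq ?_)
      congr 1
      refine Finset.prod_congr rfl fun j hj => ?_
      have hne : j ≠ i := by
        rintro rfl
        exact hi (List.mem_toFinset.mp hj)
      simp [hne]
    -- On the line through `x` in direction `e_i`, parameter `0` is `x` and parameter `-2 x_i` is
    -- its reflection.
    have hmv := Convex.norm_image_sub_le_of_norm_hasDerivWithin_le (𝕜 := ℝ) (s := Set.univ)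
      (x := -2 * x i) (y := 0)
      (fun r _ => (schwartz_hasDerivAt_line (antiSymmetrize l φ) x
        (EuclideanSpace.single i (1 : ℝ)) r).hasDerivWithinAt)
      (fun r _ => hb r) convex_univ (Set.mem_univ _) (Set.mem_univ _)
    simp only [zero_smul, add_zero, ← reflectCoord_eq_add, zero_sub, norm_neg, norm_mul,
      Real.norm_ofNat, Real.norm_eq_abs] at hmv
    have e : antiSymmetrize (i :: l) φ x = (1 / 2 : ℂ) *
        (antiSymmetrize l φ x - antiSymmetrize l φ (reflectCoord i x)) := by
      rw [← reflectSchwartz_apply]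
      rfl
    rw [e, norm_mul, List.toFinset_cons, Finset.prod_insert (by simpa using hi)]
    have h2 : ‖(1 / 2 : ℂ)‖ = 1 / 2 := by simp
    rw [h2]
    linarith

theorem schwartz_mul_c0_integrable {N : ℕ} (φ : 𝓢(RN N, ℂ)) (f : C₀(RN N, ℝ)) :
    Integrable fun x => φ x * (f x : ℂ) := by
  refine (φ.integrable (μ := volume)).mul_bdd (c := ‖f‖)
    (Complex.continuous_ofReal.comp f.continuous).aestronglyMeasurable
    (Eventually.of_forall fun x => ?_)
  simpa using c0_abs_le_norm f x

theorem integral_antiSymmetrize_mul {N m : ℕ} (φ : 𝓢(RN N, ℂ)) {f : C₀(RN N, ℝ)}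
    (hf : IsAntiSymmetric m f) (l : List (Fin N)) (hl : ∀ i ∈ l, (i : ℕ) < m) :
    ∫ x, antiSymmetrize l φ x * (f x : ℂ) = ∫ x, φ x * (f x : ℂ) := by
  induction l with
  | nil => rfl
  | cons i l ih =>
    have ih' := ih fun j hj => hl j (List.mem_cons_of_mem _ hj)
    have hi := hl i List.mem_cons_self
    have e : ∀ x, antiSymmetrize (i :: l) φ x * (f x : ℂ) = (1 / 2 : ℂ) *
        (antiSymmetrize l φ x * (f x : ℂ) -
          reflectSchwartz i (antiSymmetrize l φ) x * (f x : ℂ)) := fun x => by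
      have : antiSymmetrize (i :: l) φ x = (1 / 2 : ℂ) *
          (antiSymmetrize l φ x - reflectSchwartz i (antiSymmetrize l φ) x) := rfl
      rw [this]
      ring
    have e2 : ∫ x, reflectSchwartz i (antiSymmetrize l φ) x * (f x : ℂ) =
        -∫ x, φ x * (f x : ℂ) := by
      rw [← ih', ← integral_neg, ← integral_reflectCoord i]
      congr 1
      ext x
      rw [reflectSchwartz_apply, reflectCoord_reflectCoord, hf i hi]
      push_cast
      ring
    simp_rw [e]
    rw [integral_const_mul, integral_sub (schwartz_mul_c0_integrable _ f)
      (schwartz_mul_c0_integrable _ f), ih', e2]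
    ring

/-! ### Convergence to the initial value -/

theorem abs_coordProd {N m : ℕ} (x : RN N) :
    |coordProd N m x| = ∏ i ∈ firstIdx N m, |x i| :=
  Finset.abs_prod _ _

/-- Under `x = √t z` the weight gives `√t^m`, the monomial `√t^{-(N+m)}` and the volume `√t^N`: the
powers cancel. -/
theorem coordProd_mul_gaussMonomial {N m : ℕ} (hmN : m ≤ N) {t : ℝ} (ht : 0 < t) :
    Integrable (fun x => coordProd N m x * gaussMonomial (firstIdx N m) ht x) ∧
    ∫ x, coordProd N m x * gaussMonomial (firstIdx N m) ht x =
      ∫ x, coordProd N m x * gaussMonomial (firstIdx N m) one_pos x := by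
  constructor
  · have hg : Function.HasTemperateGrowth (coordProd N m) :=
      hasTemperateGrowth_prod _ fun i _ => hasTemperateGrowth_coord i
    have h := (SchwartzMap.smulLeftCLM ℝ (coordProd N m)
      (gaussMonomial (firstIdx N m) ht)).integrable (μ := volume)
    refine h.congr (Eventually.of_forall fun x => ?_)
    simp only [SchwartzMap.smulLeftCLM_apply_apply hg, smul_eq_mul]
  · have hst : 0 < √t := Real.sqrt_pos.mpr ht
    have h := Measure.integral_comp_smul (volume : Measure (RN N))
      (fun x => coordProd N m x * gaussMonomial (firstIdx N m) ht x) (√t)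
    have e : ∀ z : RN N, coordProd N m (√t • z) * gaussMonomial (firstIdx N m) ht (√t • z) =
        (√t ^ N)⁻¹ * (coordProd N m z * gaussMonomial (firstIdx N m) one_pos z) := fun z => by
      have e1 : coordProd N m (√t • z) = √t ^ m * coordProd N m z := by
        have e2 : √t ^ m = ∏ _i ∈ firstIdx N m, √t := by
          rw [Finset.prod_const, card_firstIdx hmN]
        rw [coordProd, coordProd, e2, ← Finset.prod_mul_distrib]
        rfl
      rw [e1, gaussMonomial_scale, card_firstIdx hmN, pow_add, mul_inv]
      field_simp
    simp_rw [e] at h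
    have hp : 0 < (√t ^ N)⁻¹ := by positivity
    rw [integral_const_mul, finrank_euclideanSpace_fin, abs_of_pos hp, smul_eq_mul] at h
    exact (mul_left_cancel₀ hp.ne' h).symm

/-- The constant is independent of `t`, although the `L¹` norm of the free orbit is not bounded as
`t → 0`; the vanishing of the anti-symmetrized test function on the coordinate hyperplanes
compensates. -/
theorem pairing_bound {N m : ℕ} (hmN : m ≤ N) (K : ℝ) (φ : 𝓢(RN N, ℂ)) :
    ∃ C, ∀ (t δ : ℝ) (f : C₀(RN N, ℝ)), 0 < t → IsAntiSymmetric m f →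
      (∀ x, |f x| ≤ δ * |freeOrbit N m K t x|) → ‖∫ x, φ x * (f x : ℂ)‖ ≤ C * δ := by
  obtain ⟨C, hC, h⟩ := antiSymmetrize_bound φ (firstList hmN) (firstList_nodup hmN)
  refine ⟨C * |K| * ∫ x, coordProd N m x * gaussMonomial (firstIdx N m) one_pos x,
    fun t δ f ht hf hb => ?_⟩
  rw [← integral_antiSymmetrize_mul φ hf (firstList hmN) fun i => (mem_firstList hmN i).mp]
  calc ‖∫ x, antiSymmetrize (firstList hmN) φ x * (f x : ℂ)‖
      ≤ ∫ x, C * |K| * δ * (coordProd N m x * gaussMonomial (firstIdx N m) ht x) := by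
        refine norm_integral_le_of_norm_le
          ((coordProd_mul_gaussMonomial hmN ht).1.const_mul _)
          (Eventually.of_forall fun x => ?_)
        have h1 := h x
        have h2 := hb x
        rw [firstList_toFinset, ← abs_coordProd] at h1
        rw [freeOrbit_apply K ht, abs_mul] at h2
        have h3 : coordProd N m x * gaussMonomial (firstIdx N m) ht x =
            |coordProd N m x| * |gaussMonomial (firstIdx N m) ht x| := by
          rw [← abs_mul, abs_of_nonneg]
          rw [gaussMonomial_firstIdx, ← mul_assoc]
          have := gaussKernel_pos N ht x
          have := mul_self_nonneg (coordProd N m x)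
          positivity
        rw [norm_mul, Complex.norm_real, Real.norm_eq_abs, h3]
        calc _ ≤ (C * |coordProd N m x|) *
              (δ * (|K| * |gaussMonomial (firstIdx N m) ht x|)) :=
              mul_le_mul h1 h2 (abs_nonneg _) (by positivity)
          _ = _ := by ring
    _ = _ := by
        rw [integral_const_mul, (coordProd_mul_gaussMonomial hmN ht).2]
        ring

theorem gaussKernel_approx_identity {N : ℕ} (ψ : 𝓢(RN N, ℂ)) :
    Tendsto (fun t => ∫ x, gaussKernel N t x • ψ x) (𝓝[>] 0) (𝓝 (ψ 0)) := by
  obtain ⟨C, -, hC⟩ := ψ.decay 0 0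
  have h1 : Tendsto (fun t => ∫ z, gaussKernel N 1 z • ψ (√t • z)) (𝓝[>] (0 : ℝ))
      (𝓝 (∫ z, gaussKernel N 1 z • ψ 0)) := by
    refine tendsto_integral_filter_of_dominated_convergence (fun z => gaussKernel N 1 z * C)
      (Eventually.of_forall fun t => ?_) (Eventually.of_forall fun t => ?_)
      ((gaussKernel_integrable N one_pos).mul_const _) (Eventually.of_forall fun z => ?_)
    · exact ((gaussKernel_continuous N 1).smul
        (ψ.continuous.comp (continuous_const_smul _))).aestronglyMeasurable
    · refine Eventually.of_forall fun z => ?_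
      rw [norm_smul, Real.norm_of_nonneg (gaussKernel_pos N one_pos z).le]
      have := hC (√t • z)
      simp only [pow_zero, one_mul, norm_iteratedFDeriv_zero] at this
      exact mul_le_mul_of_nonneg_left this (gaussKernel_pos N one_pos z).le
    · have hc : Continuous fun t : ℝ => gaussKernel N 1 z • ψ (√t • z) := by
        have := ψ.continuous
        fun_prop
      have := hc.tendsto 0
      simp only [Real.sqrt_zero, zero_smul] at this
      exact this.mono_left nhdsWithin_le_nhds
  rw [integral_smul_const, gaussKernel_integral N one_pos, one_smul] at h1
  refine h1.congr' ?_
  filter_upwards [self_mem_nhdsWithin] with t ht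
  exact (gaussKernel_integral_scale N ht fun x => ψ x).symm

/-- Integration by parts moves the derivatives from the Gaussian to `φ`, and what remains is an
approximate identity. -/
theorem freeOrbit_tendsto {N m : ℕ} (hmN : m ≤ N) (K : ℝ) (φ : 𝓢(RN N, ℂ)) :
    Tendsto (fun t => ∫ x, φ x * (freeOrbit N m K t x : ℂ)) (𝓝[>] 0)
      (𝓝 (initialDelta hmN K φ)) := by
  rw [initialDelta_apply]
  refine ((gaussKernel_approx_identity (coordDeriv (firstList hmN) φ)).const_mul
    (K : ℂ)).congr' ?_
  filter_upwards [self_mem_nhdsWithin] with t (ht : 0 < t)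
  have h := integral_gaussMonomialC_mul_coordDeriv ht φ (firstList hmN) ∅ (firstList_nodup hmN)
    (by simp)
  rw [Finset.empty_union, firstList_toFinset, gaussMonomialC_empty] at h
  simp only [gaussSchwartz_apply] at h
  simp only [Complex.real_smul]
  rw [h, ← integral_const_mul]
  congr 1
  ext x
  rw [freeOrbit_apply K ht, gaussMonomialC_apply]
  push_cast
  ring

/-- A family trapped between `e^{-A(t)} e^{tΔ} u₀` and `e^{tΔ} u₀`, with `A(t) → 0`, converges to
`u₀` in the space of tempered distributions. -/
theorem tendsto_initialDelta_of_trapped {N m : ℕ} (hmN : m ≤ N) {K : ℝ} (hK : K ≠ 0)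
    {u : ℝ → C₀(RN N, ℝ)} {A : ℝ → ℝ} (hA : Tendsto A (𝓝[>] 0) (𝓝 0))
    (hlow : ∀ t, 0 < t →
      ConeLE (signFunctionals N m K) (Real.exp (-A t) • freeOrbit N m K t) (u t))
    (hup : ∀ t, 0 < t → ConeLE (signFunctionals N m K) (u t) (freeOrbit N m K t)) :
    Tendsto (fun t => c0ToTempered (u t)) (𝓝[>] 0) (𝓝 (initialDelta hmN K)) := by
  refine PointwiseConvergenceCLM.tendsto_iff_forall_tendsto.mpr fun φ => ?_
  simp only [c0ToTempered_apply]
  obtain ⟨C, hC⟩ := pairing_bound hmN K φ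
  have hdiff : Tendsto (fun t => ∫ x, φ x * (((freeOrbit N m K t - u t) x : ℝ) : ℂ)) (𝓝[>] 0)
      (𝓝 0) := by
    have hlim : Tendsto (fun t => C * |1 - Real.exp (-A t)|) (𝓝[>] 0) (𝓝 0) := by
      have h1 : Tendsto (fun t => C * |1 - Real.exp (-A t)|) (𝓝[>] 0)
          (𝓝 (C * |1 - Real.exp (-0)|)) :=
        (((Real.continuous_exp.tendsto _).comp hA.neg).const_sub 1).abs.const_mul C
      simpa using h1
    refine squeeze_zero_norm' ?_ hlim
    filter_upwards [self_mem_nhdsWithin] with t (ht : 0 < t)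
    have h0 : ConeLE (signFunctionals N m K) 0 (freeOrbit N m K t - u t) :=
      coneLE_iff_sub.mp (hup t ht)
    -- The lower half of the trap supplies the small factor `δ = |1 - e^{-A(t)}|` for
    -- `pairing_bound`.
    have h1 : ConeLE (signFunctionals N m K) (freeOrbit N m K t - u t)
        ((1 - Real.exp (-A t)) • freeOrbit N m K t) := fun l hl => by
      have := hlow t ht l hl
      simp only [map_sub, map_smul, smul_eq_mul] at this ⊢
      linarith
    refine hC t _ _ ht (coneLE_zero_iff.mp h0).1 fun x => ?_
    have := abs_le_abs_of_coneLE hK h0 h1 x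
    rwa [ZeroAtInftyContinuousMap.coe_smul, Pi.smul_apply, smul_eq_mul, abs_mul] at this
  have := (freeOrbit_tendsto hmN K φ).sub hdiff
  rw [sub_zero] at this
  refine this.congr fun t => ?_
  rw [← integral_sub (schwartz_mul_c0_integrable _ _) (schwartz_mul_c0_integrable _ _)]
  congr 1
  ext x
  simp only [ZeroAtInftyContinuousMap.coe_sub, Pi.sub_apply]
  push_cast
  ring

/-! ### The solution -/

/-- The rate is `(α+1) M^α` with `M` the bound on `‖H(t)‖`, which produces `B` and `β`. The
condition `β < 1` makes the rate integrable and its primitive vanish continuously at `0`. -/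
theorem heat_absorptionSetting {N m : ℕ} (hmN : m ≤ N) {α : ℝ} (hα : 0 < α) {K β B : ℝ}
    (hK : K ≠ 0) (hβ : β = α * (((N : ℝ) + m) / 2)) (hβ1 : β < 1)
    (hB : B = (α + 1) * ‖freeOrbit N m K 1‖ ^ α) :
    AbsorptionSetting (signFunctionals N m K) (heatCLM N) (powNonlin hα) (freeOrbit N m K)
      (fun t => B * t ^ (-β)) (fun t => B / (1 - β) * t ^ (1 - β)) where
  semigroup_cont := heatCLM_continuous N
  semigroup_zero f := heatC0_of_nonpos le_rfl f
  semigroup_add s t f hs ht := heatC0_add hs ht f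
  semigroup_norm t f := heatC0_norm_le t f
  semigroup_mono t f hf := heatC0_nonneg t hf
  norm_mono f g hf hfg := norm_le_of_coneLE hK hf hfg
  nl_cont := powNonlin_continuous hα
  nl_zero := powNonlin_zero hα
  nl_mono t f g ht hf hfg hg := by
    have h0 : ConeLE (signFunctionals N m K) 0 g := fun l hl => (hf l hl).trans (hfg l hl)
    have hn : ‖g‖ ≤ t ^ (-((N : ℝ) + m) / 2) * ‖freeOrbit N m K 1‖ :=
      (norm_le_of_coneLE hK h0 hg).trans (freeOrbit_norm_le hmN K ht)
    have e : (α + 1) * (t ^ (-((N : ℝ) + m) / 2) * ‖freeOrbit N m K 1‖) ^ α = B * t ^ (-β) := by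
      rw [Real.mul_rpow (by positivity) (norm_nonneg _), ← Real.rpow_mul ht.le, hB, hβ]
      ring_nf
    have := powNonlin_mono hα hf hfg hn
    rwa [e] at this
  orbit_cont := freeOrbit_continuousOn K
  orbit_nonneg t ht := freeOrbit_nonneg K ht
  orbit_semigroup t s ht hs := freeOrbit_semigroup K ht hs
  rate_nonneg t ht := by
    rw [hB]
    positivity
  rate_cont := continuousOn_const.mul
    (continuousOn_id.rpow_const fun t (ht : 0 < t) => Or.inl ht.ne')
  rate_int t ht := (intervalIntegral.intervalIntegrable_rpow' (by linarith)).const_mul _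
  prim_zero := by rw [Real.zero_rpow (by linarith), mul_zero]
  prim_cont := continuousOn_const.mul
    (continuousOn_id.rpow_const fun t _ => Or.inr (by linarith))
  prim_deriv t ht := by
    refine ((Real.hasDerivAt_rpow_const (p := 1 - β) (Or.inl ht.ne')).const_mul _).congr_deriv ?_
    have : 1 - β ≠ 0 := by linarith
    rw [show 1 - β - 1 = -β by ring]
    field_simp

theorem mainTheorem9 (N m : ℕ) (hm : 1 ≤ m) (hmN : m ≤ N)
    (α : ℝ) (hα : 0 < α) (hα' : α < 2 / ((N : ℝ) + (m : ℝ)))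
    (K : ℝ) (hK : K ≠ 0) :
    ∃ u : ℝ → C₀(RN N, ℝ),
      ContinuousOn u (Set.Ioi 0) ∧
      IsGlobalIntegralSolution (-1) hα (initialDelta hmN K) u ∧
      Tendsto (fun t => c0ToTempered (u t)) (𝓝[>] 0) (𝓝 (initialDelta hmN K)) ∧
      (∀ t : ℝ, 0 < t → IsAntiSymmetric m (u t)) ∧
      (0 < K → ∀ t : ℝ, 0 < t → ∀ x ∈ sector N m, 0 < u t x) := by
  have hm0 : (0 : ℝ) < m := by exact_mod_cast hm
  have hNm : (0 : ℝ) < (N : ℝ) + m := by positivity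
  -- This is the subcriticality assumption in the form in which it is used.
  have hβ1 : α * (((N : ℝ) + m) / 2) < 1 := by
    rw [lt_div_iff₀ hNm] at hα'
    linarith
  have hset := heat_absorptionSetting hmN hα hK rfl hβ1 rfl
  obtain ⟨u, huc, hu⟩ := hset.exists_solution
  have hpos : ∀ t, 0 < t → ConeLE (signFunctionals N m K) 0 (u t) := fun t ht l hl => by
    have h1 := (hu t ht).1 l hl
    have h2 := freeOrbit_nonneg K ht l hl
    rw [map_smul, smul_eq_mul] at h1
    rw [map_zero] at h2 ⊢
    exact (mul_nonneg (Real.exp_pos _).le h2).trans h1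
  refine ⟨u, huc, fun t ht => ⟨(hu t ht).2.2.1, fun x => ?_⟩, ?_, fun t ht => ?_,
    fun hK0 t ht x hx => ?_⟩
  · have h1 := congrArg (fun f : C₀(RN N, ℝ) => f x) (hu t ht).2.2.2
    simp only [heatCLM_apply, ZeroAtInftyContinuousMap.coe_sub, Pi.sub_apply] at h1
    rw [heatDistribution_initialDelta, h1, ZeroAtInftyContinuousMap.coe_smul, Pi.smul_apply,
      smul_eq_mul]
    push_cast
    ring
  · refine tendsto_initialDelta_of_trapped hmN hK ?_ (fun t ht => (hu t ht).1)
      fun t ht => (hu t ht).2.1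
    have h1 := hset.prim_cont 0 Set.self_mem_Ici
    have h2 := h1.tendsto.mono_left (nhdsWithin_mono 0 Set.Ioi_subset_Ici_self)
    rwa [hset.prim_zero] at h2
  · exact (coneLE_zero_iff.mp (hpos t ht)).1
  · have hp : 0 < coordProd N m x :=
      Finset.prod_pos fun i hi => hx i (mem_firstIdx.mp hi)
    have h1 := (coneLE_iff.mp (hu t ht).1).2 x
    -- On the sector the weight is positive, so the order becomes the pointwise one and `u ≥ e^{-A}
    -- H > 0`.
    have h2 := le_of_mul_le_mul_left h1 (mul_pos hK0 hp)
    refine lt_of_lt_of_le ?_ h2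
    rw [ZeroAtInftyContinuousMap.coe_smul, Pi.smul_apply, smul_eq_mul, freeOrbit_apply K ht,
      gaussMonomial_firstIdx]
    have := gaussKernel_pos N ht x
    positivity
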